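/- **Proposition (Geometric and dynamical R-matrices coincide).** Let $n\ge 0$, $[n]=\{1,\dots,n\}$, and let $\mathcal L$ be the algebra of rational functions generated over $\mathbb C[z_1,\dots,z_n,y]$ by $\lambda$, $(\lambda+ly)^{-1}$ ($l\in\mathbb Z$), $(z_i-z_j)^{-1}$ ($i\ne j$) and $(z_i-z_j-y)^{-1}$ (all $i,j$). For $0\le k\le n$ use the presentation $$H_k:=H_T^*(T^*\mathrm{Gr}_k(\mathbb C^n))=\mathbb C[\gamma_{1,1},\dots,\gamma_{1,k},\gamma_{2,1},\dots,\gamma_{2,n-k},z_1,\dots,z_n,y]^{S_k\times S_{n-k}}\Big/\Big(\prod_{i=1}^k(u-\gamma_{1,i})\prod_{i=1}^{n-k}(u-\gamma_{2,i})=\prod_{i=1}^n(u-z_i)\Big),$$ where all coefficients in $u$ are equated and $T=(\mathbb C^\times)^n\times\mathbb C^\times$. The restriction $f\mapsto f|_{x_J}$ to the fixed point $x_J$ ($J\subset[n]$, $|J|=k$) is the substitution $\{\gamma_{1,*}\}\mapsto \mathbf z_J:=\{z_a\mid a\in J\}$, $\{\gamma_{2,*}\}\mapsto\{z_a\mid a\notin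 J\}$, extended $\mathcal L$-linearly to $H_k\otimes_{\mathbb C[\mathbf z,y]}\mathcal L$. Let $\mathcal X_n=\coprod_{k=0}^n T^*\mathrm{Gr}_k(\mathbb C^n)$, so that $H_T^*(\mathcal X_n)\otimes\mathcal L=\bigoplus_{k=0}^n H_k\otimes\mathcal L$. For $I=\{i_1<\dots<i_k\}\subset[n]$ and $i\in I$ put $w(i,I)=-\#\{j>i\mid j\notin I\}+\#\{j>i\mid j\in I\}$. Let $l_I(r,a)$ be $t_r-z_a+y$ if $a<i_r$, $\lambda+t_r-z_a-w(i_r,I)y$ if $a=i_r$, and $t_r-z_a$ if $a>i_r$. Define $$W_I(\lambda,\mathbf t,\mathbf z,y)=y^k\,\mathrm{Sym}_{t_1,\dots,t_k}\Big(\prod_{r=1}^k\prod_{a=1}^n l_I(r,a)\prod_{1\le a<b\le k}\frac{t_a-t_b+y}{t_a-t_b}\Big),$$ where $\mathrm{Sym}$ is the sum over all permutations of $t_1,\dots,t_k$. For $\sigma\in S_n$ define $W_{\sigma,I}(\lambda,\mathbf t,\mathbf z,y)=W_{\sigma^{-1}(I)}(\lambda,\mathbf t,z_{\sigma(1)},\dots,z_{\sigma(n)},y)$,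 $C^{(r)}_{\sigma,I}=\prod_{i\in I}\big(\lambda-(w(\sigma^{-1}(i),\sigma^{-1}(I))+r)y\big)$ and $$\tilde W^+_{\sigma,I}=\frac{W_{\sigma,I}}{C^{(0)}_{\sigma,I}\,C^{(1)}_{\sigma,I}\,\prod_{a,b=1}^k(t_a-t_b+y)}.$$ Let $v_1,v_2$ be the standard basis of $\mathbb C^2$, and for $I\subset[n]$ let $v_I=v_{i_1}\otimes\dots\otimes v_{i_n}\in(\mathbb C^2)^{\otimes n}$ with $i_j=1$ if $j\in I$ and $i_j=2$ if $j\notin I$. Put $h(v_1)=1$, $h(v_2)=-1$, and let $h^{(j)}$ act as $h$ in the $j$-th factor. Let $R(\lambda,z,y)$ be the matrix $$\begin{pmatrix}1&0&0&0\\0&\frac{(\lambda+y)z}{\lambda(z-y)}&-\frac{(\lambda+z)y}{\lambda(z-y)}&0\\0&-\frac{(\lambda-z)y}{\lambda(z-y)}&\frac{(\lambda-y)z}{\lambda(z-y)}&0\\0&0&0&1\end{pmatrix}$$ in the basis $v_1\otimes v_1,\ v_1\otimes v_2,\ v_2\otimes v_1,\ v_2\otimes v_2$ (columns are the images of the basis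 vectors). Let $R^{(i,j)}$ denote $R$ acting in the $i$-th and $j$-th factors, in this order, of $(\mathbb C^2)^{\otimes n}\otimes\mathcal L$. In $R^{(i,j)}(\lambda-y\sum_s h^{(s)},\cdot,\cdot)$ the $h^{(s)}$ are replaced by their eigenvalues on the elementary tensor to which the operator is applied. Then the following hold. 1. For all $\sigma\in S_n$ and $I\subset[n]$, $|I|=k$, there is a unique class $\kappa_{\sigma,I}\in H_k\otimes\mathcal L$ with $\kappa_{\sigma,I}|_{x_J}=\tilde W^+_{\sigma,I}(\lambda,\mathbf z_J,\mathbf z,y)$ for all $J\subset[n]$ with $|J|=k$. 2. For every $\sigma\in S_n$ the $\mathcal L$-linear map $\mathrm{Stab}_\sigma:(\mathbb C^2)^{\otimes n}\otimes\mathcal L=H_T^*(\mathcal X_n^T)\otimes\mathcal L\to H_T^*(\mathcal X_n)\otimes\mathcal L$, $v_I\mapsto\kappa_{\sigma,I}$, is an isomorphism. 3. For every $\sigma\in S_n$ and $a=1,\dots,n-1$, with $s_{a,a+1}$ the transposition of $a$ and $a+1$, $$\mathrm{Stab}_{\sigma s_{a,a+1}}^{-1}\circ\mathrm{Stab}_\sigma=R^{(\sigma(a+1),\sigma(a))}\Big(\lambda-y\sum_{i=a+2}^n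 h^{(\sigma(i))},\ z_{\sigma(a+1)}-z_{\sigma(a)},\ y\Big).$$ -/

import Mathlib

/-!
Cohomology of cotangent bundles of Grassmannians, rational dynamical weight functions, dynamical
stable envelope maps, and the rational dynamical R-matrix.

Positions `1, …, n` are represented by `Fin n`, that is by `0, …, n - 1`.
A `k`-element subset of `[n]` is `I : Finset (Fin n)` with `I.card = k`.
-/

open scoped TensorProduct

namespace DynStab

noncomputable section

/-! ### Coefficient rings -/

/-- `H_T^*(pt) = ℂ[z₁, …, zₙ, y]`; the variable `some i` is `zᵢ` and the variable `none` is `y`. -/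
abbrev Pol (n : ℕ) : Type := MvPolynomial (Option (Fin n)) ℂ

/-- The polynomial `zᵢ`. -/
def polZ (n : ℕ) (i : Fin n) : Pol n := MvPolynomial.X (some i)

/-- The polynomial `y`. -/
def polY (n : ℕ) : Pol n := MvPolynomial.X none

/-- The field of rational functions `ℂ(λ, z₁, …, zₙ, y)`, as the fraction field of
`ℂ[z, y][λ]`. -/
abbrev RatFun (n : ℕ) : Type := FractionRing (Polynomial (Pol n))

/-- The rational function `λ`. -/
def lam (n : ℕ) : RatFun n := algebraMap (Polynomial (Pol n)) (RatFun n) Polynomial.X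

/-- The rational function `zᵢ`. -/
def z (n : ℕ) (i : Fin n) : RatFun n := algebraMap (Pol n) (RatFun n) (polZ n i)

/-- The rational function `y`. -/
def y (n : ℕ) : RatFun n := algebraMap (Pol n) (RatFun n) (polY n)

/-- The algebra `𝓛_{z,y}`: polynomials in `z, y` with the denominators `zᵢ - zⱼ` (`i ≠ j`) and
`zᵢ - zⱼ - y` (all `i, j`) permitted. -/
def ringZY (n : ℕ) : Subalgebra (Pol n) (RatFun n) :=
  Algebra.adjoin (Pol n)
    ({f | ∃ i j, i ≠ j ∧ f = (z n i - z n j)⁻¹} ∪ {f | ∃ i j, f = (z n i - z n j - y n)⁻¹})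

/-- The algebra `𝓛_{λ,z,y} = 𝓛_{λ,y} ⊗_{ℂ[y]} 𝓛_{z,y}`, realized inside the field of rational
functions: it is obtained from `𝓛_{z,y}` by adjoining the variable `λ` and the inverses of
`λ + l y`, `l ∈ ℤ`. -/
def ringL (n : ℕ) : Subalgebra (Pol n) (RatFun n) :=
  Algebra.adjoin (Pol n) ({lam n} ∪ {f | ∃ l : ℤ, f = (lam n + (l : RatFun n) * y n)⁻¹}) ⊔ ringZY n

/-- The ring `𝓛_{λ,z,y}` as a type. -/
abbrev L (n : ℕ) : Type := ringL n

instance (n : ℕ) : CommRing (L n) := inferInstance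

instance (n : ℕ) : Algebra (Pol n) (L n) := inferInstance

instance (n : ℕ) : Algebra ℂ (L n) := inferInstance

/-! ### Equivariant cohomology of the cotangent bundle of a Grassmannian

The presentation of the cohomology algebra is set up over an arbitrary commutative ring `A` with
elements `x₁, …, xₙ`, and then used for `A = ℂ[z, y]` and `xᵢ = zᵢ`. -/

/-- The Chern roots `Γ`: `Sum.inl r` is `γ_{1,r}` (tautological subbundle), `Sum.inr r` is
`γ_{2,r}` (quotient bundle). -/
abbrev Roots (n k : ℕ) : Type := Fin k ⊕ Fin (n - k)

section Presentation

variable {A : Type*} [CommRing A] {n : ℕ}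

/-- The invariants `A[Γ]^{S_k × S_{n-k}}`. -/
def symPol (A : Type*) [CommRing A] (n k : ℕ) : Subalgebra A (MvPolynomial (Roots n k) A) where
  carrier := {f | ∀ (s : Equiv.Perm (Fin k)) (t : Equiv.Perm (Fin (n - k))),
    MvPolynomial.rename (Equiv.sumCongr s t) f = f}
  mul_mem' hf hg s t := by rw [map_mul, hf s t, hg s t]
  add_mem' hf hg s t := by rw [map_add, hf s t, hg s t]
  algebraMap_mem' r s t := by rw [AlgHom.commutes]

/-- The polynomial `∏ᵢ (u - γ_{1,i}) ∏ᵢ (u - γ_{2,i}) - ∏ᵢ (u - xᵢ)` in the variable `u`. -/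
def relPol (x : Fin n → A) (k : ℕ) : Polynomial (MvPolynomial (Roots n k) A) :=
  (∏ i : Fin k, (Polynomial.X - Polynomial.C (MvPolynomial.X (Sum.inl i)))) *
      (∏ i : Fin (n - k), (Polynomial.X - Polynomial.C (MvPolynomial.X (Sum.inr i)))) -
    ∏ i : Fin n, (Polynomial.X - Polynomial.C (MvPolynomial.C (x i)))

theorem relPol_coeff_mem (x : Fin n → A) (k m : ℕ) : (relPol x k).coeff m ∈ symPol A n k := by
  intro s t
  have key : (relPol x k).map
      (MvPolynomial.rename (R := A) (Equiv.sumCongr s t)).toRingHom = relPol x k := by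
    simp only [relPol, Polynomial.map_sub, Polynomial.map_mul, Polynomial.map_prod,
      Polynomial.map_X, Polynomial.map_C, AlgHom.toRingHom_eq_coe, RingHom.coe_coe,
      MvPolynomial.rename_X, MvPolynomial.rename_C, Equiv.sumCongr_apply, Sum.map_inl, Sum.map_inr]
    congr 2
    · exact Equiv.prod_comp s (fun i => Polynomial.X - Polynomial.C
        (MvPolynomial.X (R := A) (Sum.inl i : Roots n k)))
    · exact Equiv.prod_comp t (fun i => Polynomial.X - Polynomial.C
        (MvPolynomial.X (R := A) (Sum.inr i : Roots n k)))
  have h2 := congrArg (fun p => Polynomial.coeff p m) key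
  simpa [Polynomial.coeff_map] using h2

/-- The ideal of relations: every coefficient of `relPol` is set to zero. -/
def relIdeal (x : Fin n → A) (k : ℕ) : Ideal (symPol A n k) :=
  Ideal.span (Set.range fun m : ℕ =>
    (⟨(relPol x k).coeff m, relPol_coeff_mem x k m⟩ : symPol A n k))

/-- `A[Γ]^{S_k × S_{n-k}} / (∏(u - γ₁)∏(u - γ₂) = ∏(u - x))`. -/
def CohQuot (x : Fin n → A) (k : ℕ) : Type _ := symPol A n k ⧸ relIdeal x k

instance (x : Fin n → A) (k : ℕ) : CommRing (CohQuot x k) :=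
  inferInstanceAs (CommRing (symPol A n k ⧸ relIdeal x k))

instance (x : Fin n → A) (k : ℕ) : Algebra A (CohQuot x k) :=
  inferInstanceAs (Algebra A (symPol A n k ⧸ relIdeal x k))

theorem card_compl_eq {k : ℕ} (J : Finset (Fin n)) (hJ : J.card = k) : Jᶜ.card = n - k := by
  rw [Finset.card_compl, Fintype.card_fin, hJ]

/-- The position substituted for a Chern root at the fixed point `x_J`:
`{γ_{1,*}} ↦ J`, `{γ_{2,*}} ↦ complement of J`. -/
def rootAt {k : ℕ} (J : Finset (Fin n)) (hJ : J.card = k) : Roots n k → Fin n :=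
  Sum.elim (J.orderEmbOfFin hJ) (Jᶜ.orderEmbOfFin (card_compl_eq J hJ))

/-- The substitution `{γ_{1,*}} ↦ {x_a | a ∈ J}`, `{γ_{2,*}} ↦ {x_a | a ∉ J}` on polynomials. -/
def subst (x : Fin n → A) {k : ℕ} (J : Finset (Fin n)) (hJ : J.card = k) :
    MvPolynomial (Roots n k) A →ₐ[A] A :=
  MvPolynomial.aeval fun g => x (rootAt J hJ g)

theorem prod_orderEmb {M : Type*} [CommMonoid M] {k : ℕ} (J : Finset (Fin n))
    (hJ : J.card = k) (f : Fin n → M) : ∏ r : Fin k, f (J.orderEmbOfFin hJ r) = ∏ a ∈ J, f a := by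
  conv_rhs => rw [← J.image_orderEmbOfFin_univ hJ]
  rw [Finset.prod_image]
  intro a _ b _ h
  exact (J.orderEmbOfFin hJ).injective h

theorem subst_rel (x : Fin n → A) {k : ℕ} (J : Finset (Fin n)) (hJ : J.card = k) (m : ℕ) :
    subst x J hJ ((relPol x k).coeff m) = 0 := by
  have key : (relPol x k).map (subst x J hJ).toRingHom = 0 := by
    simp only [relPol, subst, rootAt, Polynomial.map_sub, Polynomial.map_mul, Polynomial.map_prod,
      Polynomial.map_X, Polynomial.map_C, AlgHom.toRingHom_eq_coe, RingHom.coe_coe,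
      MvPolynomial.aeval_X, MvPolynomial.aeval_C, Sum.elim_inl, Sum.elim_inr,
      Algebra.algebraMap_self, RingHom.id_apply]
    rw [prod_orderEmb J hJ (fun a => Polynomial.X - Polynomial.C (x a)),
      prod_orderEmb Jᶜ (card_compl_eq J hJ) (fun a => Polynomial.X - Polynomial.C (x a)),
      Finset.prod_mul_prod_compl, sub_self]
  have h2 := congrArg (fun p => Polynomial.coeff p m) key
  simpa [Polynomial.coeff_map] using h2

/-- The algebra map induced on the quotient by the substitution at `J`. -/
def quotSubst (x : Fin n → A) {k : ℕ} (J : Finset (Fin n)) (hJ : J.card = k) :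
    CohQuot x k →ₐ[A] A :=
  Ideal.Quotient.liftₐ (relIdeal x k) ((subst x J hJ).comp (symPol A n k).val) (by
    intro a ha
    change a ∈ RingHom.ker ((subst x J hJ).comp (symPol A n k).val)
    refine (Ideal.span_le.mpr ?_ : relIdeal x k ≤ _) ha
    rintro _ ⟨m, rfl⟩
    exact subst_rel x J hJ m)

end Presentation

/-- `H_T^*(T^*Gr_k(ℂⁿ)) = ℂ[Γ, z, y]^{S_k × S_{n-k}} / (∏(u - γ₁)∏(u - γ₂) = ∏(u - z))`. -/
abbrev H (n k : ℕ) : Type := CohQuot (polZ n) k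

/-- `H_T^*(T^*Gr_k(ℂⁿ)) ⊗ 𝓛_{λ,z,y}`, the tensor product being over `ℂ[z, y]`. -/
def HL (n k : ℕ) : Type := L n ⊗[Pol n] H n k

instance (n k : ℕ) : CommRing (HL n k) := inferInstanceAs (CommRing (L n ⊗[Pol n] H n k))

instance (n k : ℕ) : Algebra (L n) (HL n k) := inferInstanceAs (Algebra (L n) (L n ⊗[Pol n] H n k))

/-- `H_T^*(𝓧ₙ) ⊗ 𝓛_{λ,z,y}`, where `𝓧ₙ` is the disjoint union of the `T^*Gr_k(ℂⁿ)`,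
`0 ≤ k ≤ n`. -/
abbrev HX (n : ℕ) : Type := ∀ k : Fin (n + 1), HL n k

/-! ### Equivariant localization -/

/-- The component `Loc_J` of equivariant localization, that is the restriction to `x_J`. -/
def loc {n k : ℕ} (J : Finset (Fin n)) (hJ : J.card = k) : H n k →ₐ[Pol n] Pol n :=
  quotSubst (polZ n) J hJ

/-- The restriction to `x_J` with coefficients extended to `𝓛_{λ,z,y}`: `l ⊗ f ↦ l · Loc_J f`. -/
def locL {n k : ℕ} (J : Finset (Fin n)) (hJ : J.card = k) : HL n k →ₐ[L n] L n :=
  Algebra.TensorProduct.lift (AlgHom.id (L n) (L n))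
    ((Algebra.ofId (Pol n) (L n)).comp (loc J hJ)) (fun _ _ => Commute.all _ _)

/-! ### Weight functions -/

/-- `w(i, I) = - #{j > i, j ∉ I} + #{j > i, j ∈ I}`. -/
def w {n : ℕ} (i : Fin n) (I : Finset (Fin n)) : ℤ :=
  -((Finset.univ.filter fun j => i < j ∧ j ∉ I).card : ℤ) +
    ((Finset.univ.filter fun j => i < j ∧ j ∈ I).card : ℤ)

/-- `σ⁻¹(I)`. -/
def preim {n : ℕ} (σ : Equiv.Perm (Fin n)) (I : Finset (Fin n)) : Finset (Fin n) :=
  I.map σ.symm.toEmbedding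

theorem card_preim {n k : ℕ} (σ : Equiv.Perm (Fin n)) {I : Finset (Fin n)} (hI : I.card = k) :
    (preim σ I).card = k := by
  rw [preim, Finset.card_map, hI]

section Weight

variable {F : Type*} [Field F] {n k : ℕ}

/-- `C^{(r)}_{σ,I} = ∏_{i ∈ I} (λ - (w(σ⁻¹(i), σ⁻¹(I)) + r) y)`. -/
def C (r : ℤ) (σ : Equiv.Perm (Fin n)) (I : Finset (Fin n)) (lam y : F) : F :=
  ∏ i ∈ I, (lam - ((w (σ.symm i) (preim σ I) + r : ℤ) : F) * y)

/-- The factor `l_I(r, a)`, where `i = i_r` is the `r`-th element of `I` and `t = t_r`. -/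
def lFactor (I : Finset (Fin n)) (i a : Fin n) (lam t : F) (z : Fin n → F) (y : F) : F :=
  if a < i then t - z a + y
  else if a = i then lam + t - z a - (w i I : F) * y
  else t - z a

/-- The function that is symmetrized in the definition of `W_I`; here
`I = {i₁ < … < i_k}`. -/
def preWeight (I : Finset (Fin n)) (hI : I.card = k) (lam : F) (t : Fin k → F) (z : Fin n → F)
    (y : F) : F :=
  (∏ r : Fin k, ∏ a : Fin n, lFactor I (I.orderEmbOfFin hI r) a lam (t r) z y) *
    ∏ a : Fin k, ∏ b ∈ Finset.univ.filter (fun b : Fin k => a < b), (t a - t b + y) / (t a - t b)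

/-- `W_I(λ, t, z, y)`. This is a polynomial in all arguments; the formula computes its value at
every point with pairwise distinct `t₁, …, t_k`. -/
def weight (I : Finset (Fin n)) (hI : I.card = k) (lam : F) (t : Fin k → F) (z : Fin n → F)
    (y : F) : F :=
  y ^ k * ∑ s : Equiv.Perm (Fin k), preWeight I hI lam (t ∘ s) z y

/-- `W_{σ,I}(λ, t, z, y) = W_{σ⁻¹(I)}(λ, t, z_{σ(1)}, …, z_{σ(n)}, y)`. -/
def weightPerm (σ : Equiv.Perm (Fin n)) (I : Finset (Fin n)) (hI : I.card = k) (lam : F)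
    (t : Fin k → F) (z : Fin n → F) (y : F) : F :=
  weight (preim σ I) (card_preim σ hI) lam t (z ∘ σ) y

/-- `e_k(t, y) = ∏_{a,b} (t_a - t_b + y)`. -/
def e (t : Fin k → F) (y : F) : F := ∏ a : Fin k, ∏ b : Fin k, (t a - t b + y)

/-- `W̃⁺_{σ,I} = W_{σ,I} / (C⁽⁰⁾_{σ,I} C⁽¹⁾_{σ,I} e_k)`. -/
def weightPlus (σ : Equiv.Perm (Fin n)) (I : Finset (Fin n)) (hI : I.card = k) (lam : F)
    (t : Fin k → F) (z : Fin n → F) (y : F) : F :=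
  weightPerm σ I hI lam t z y / (C 0 σ I lam y * C 1 σ I lam y * e t y)

end Weight

/-- `W̃⁺_{σ,I}(λ, z_J, z, y)`, as a rational function of `λ, z, y`. The entries of `z_J` are
distinct variables, so no denominator vanishes. -/
def weightPlusAt {n k : ℕ} (σ : Equiv.Perm (Fin n)) (I : Finset (Fin n)) (hI : I.card = k)
    (J : Finset (Fin n)) (hJ : J.card = k) : RatFun n :=
  weightPlus σ I hI (lam n) (fun r => z n (J.orderEmbOfFin hJ r)) (z n) (y n)

/-! ### Dynamical stable envelope maps -/

/-- `κ ∈ H_T^*(T^*Gr_k(ℂⁿ)) ⊗ 𝓛_{λ,z,y}` (with `k = |I|`) has the restrictions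
`κ|_{x_J} = W̃⁺_{σ,I}(λ, z_J, z, y)` at all fixed points `x_J` of `T^*Gr_k(ℂⁿ)`. -/
def IsStableClass {n : ℕ} (σ : Equiv.Perm (Fin n)) (I : Finset (Fin n)) (κ : HL n I.card) : Prop :=
  ∀ (J : Finset (Fin n)) (hJ : J.card = I.card),
    ((locL J hJ κ : L n) : RatFun n) = weightPlusAt σ I rfl J hJ

/-- The class `κ_{σ,I}` determined by its restrictions. -/
def stableClass {n : ℕ} (σ : Equiv.Perm (Fin n)) (I : Finset (Fin n)) : HL n I.card :=
  Classical.epsilon (IsStableClass σ I)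

/-- `κ_{σ,I}` as an element of `H_T^*(𝓧ₙ) ⊗ 𝓛_{λ,z,y}`. -/
def stableClassX {n : ℕ} (σ : Equiv.Perm (Fin n)) (I : Finset (Fin n)) : HX n :=
  Pi.single (M := fun k : Fin (n + 1) => HL n k)
    (⟨I.card, Nat.lt_succ_of_le (card_finset_fin_le I)⟩ : Fin (n + 1)) (stableClass σ I)

/-- `(ℂ²)^{⊗n}`. -/
abbrev TensorPower (n : ℕ) : Type := ⨂[ℂ] _ : Fin n, (Fin 2 → ℂ)

/-- `(ℂ²)^{⊗n} ⊗ 𝓛_{λ,z,y} = H_T^*(𝓧ₙ^T) ⊗ 𝓛_{λ,z,y}`. -/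
def V (n : ℕ) : Type := L n ⊗[ℂ] TensorPower n

instance (n : ℕ) : AddCommGroup (V n) := inferInstanceAs (AddCommGroup (L n ⊗[ℂ] TensorPower n))

instance (n : ℕ) : Module (L n) (V n) := inferInstanceAs (Module (L n) (L n ⊗[ℂ] TensorPower n))

/-- The basis of elementary tensors `v_{c 1} ⊗ … ⊗ v_{c n}`. The standard basis vectors `v₁, v₂`
of `ℂ²` have the indices `0` and `1` of `Fin 2`. -/
def basisV (n : ℕ) : Module.Basis (Fin n → Fin 2) (L n) (V n) :=
  Algebra.TensorProduct.basis (L n)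
    (Basis.piTensorProduct (fun _ : Fin n => Pi.basisFun ℂ (Fin 2)))

/-- The set `I` of the positions `j` whose tensor factor `v_{c j}` is `v₁` (index `0`), so that the
elementary tensor `v_{c 1} ⊗ … ⊗ v_{c n}` is `v_I`, corresponding to `1_I`. -/
def subsetOf {n : ℕ} (c : Fin n → Fin 2) : Finset (Fin n) := Finset.univ.filter fun j => c j = 0

/-- The dynamical stable envelope map `v_I ↦ κ_{σ,I}`. -/
def stab {n : ℕ} (σ : Equiv.Perm (Fin n)) : V n →ₗ[L n] HX n :=
  (basisV n).constr (L n) fun c => stableClassX σ (subsetOf c)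

/-- The geometric R-matrix `Stab_{σ'}⁻¹ ∘ Stab_σ`. -/
def geomR {n : ℕ} (hStab : ∀ σ : Equiv.Perm (Fin n), Function.Bijective (stab σ))
    (σ' σ : Equiv.Perm (Fin n)) : Module.End (L n) (V n) :=
  (LinearEquiv.ofBijective (stab σ') (hStab σ')).symm.toLinearMap ∘ₗ stab σ

/-! ### The rational dynamical R-matrix -/

/-- The entry of `R(λ, z, y)` in row `v_p ⊗ v_q` and column `v_{p'} ⊗ v_{q'}`: the coefficient of
`v_p ⊗ v_q` in the image of `v_{p'} ⊗ v_{q'}`. -/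
def rEntry {F : Type*} [Field F] (lam z y : F) : Fin 2 × Fin 2 → Fin 2 × Fin 2 → F
  | (0, 0), (0, 0) => 1
  | (0, 1), (0, 1) => ((lam + y) * z) / (lam * (z - y))
  | (0, 1), (1, 0) => -(((lam + z) * y) / (lam * (z - y)))
  | (1, 0), (0, 1) => -(((lam - z) * y) / (lam * (z - y)))
  | (1, 0), (1, 0) => ((lam - y) * z) / (lam * (z - y))
  | (1, 1), (1, 1) => 1
  | _, _ => 0

/-- The weights `h(v₁) = 1`, `h(v₂) = -1`. -/
def hWeight : Fin 2 → ℤ := ![1, -1]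

theorem lam_mem (n : ℕ) : lam n ∈ ringL n :=
  (le_sup_left : _ ≤ ringL n) (Algebra.subset_adjoin (Or.inl rfl))

theorem z_mem (n : ℕ) (i : Fin n) : z n i ∈ ringL n := (ringL n).algebraMap_mem _

theorem y_mem (n : ℕ) : y n ∈ ringL n := (ringL n).algebraMap_mem _

theorem inv_lam_mem (n : ℕ) (l : ℤ) : (lam n - (l : RatFun n) * y n)⁻¹ ∈ ringL n :=
  (le_sup_left : _ ≤ ringL n) (Algebra.subset_adjoin (Or.inr ⟨-l, by push_cast; ring⟩))

theorem inv_z_mem (n : ℕ) (i j : Fin n) : (z n i - z n j - y n)⁻¹ ∈ ringL n :=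
  (le_sup_right : ringZY n ≤ ringL n) (Algebra.subset_adjoin (Or.inr ⟨i, j, rfl⟩))

theorem rEntry_mem (n : ℕ) (l : ℤ) (i j : Fin n) (p q : Fin 2 × Fin 2) :
    rEntry (lam n - (l : RatFun n) * y n) (z n i - z n j) (y n) p q ∈ ringL n := by
  have h1 : lam n - (l : RatFun n) * y n ∈ ringL n :=
    sub_mem (lam_mem n) (mul_mem (intCast_mem _ l) (y_mem n))
  have h2 : z n i - z n j ∈ ringL n := sub_mem (z_mem n i) (z_mem n j)
  have h3 : ((lam n - (l : RatFun n) * y n) * (z n i - z n j - y n))⁻¹ ∈ ringL n := by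
    rw [mul_inv]
    exact mul_mem (inv_lam_mem n l) (inv_z_mem n i j)
  unfold rEntry
  split
  · exact one_mem _
  · exact mul_mem (mul_mem (add_mem h1 (y_mem n)) h2) h3
  · exact neg_mem (mul_mem (mul_mem (add_mem h1 h2) (y_mem n)) h3)
  · exact neg_mem (mul_mem (mul_mem (sub_mem h1 h2) (y_mem n)) h3)
  · exact mul_mem (mul_mem (sub_mem h1 (y_mem n)) h2) h3
  · exact one_mem _
  · exact zero_mem _

/-- The operator `R^{(p,q)}(λ - y ∑_{s ∈ S} h^{(s)}, z_i - z_j, y)` on `(ℂ²)^{⊗n} ⊗ 𝓛_{λ,z,y}`: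
on an elementary tensor `v_{c 1} ⊗ … ⊗ v_{c n}` the R-matrix
`R(λ - (∑_{s ∈ S} h(v_{c s})) y, z_i - z_j, y)` acts in the factors `p` and `q` (in this order). -/
def dynR {n : ℕ} (p q : Fin n) (S : Finset (Fin n)) (i j : Fin n) : Module.End (L n) (V n) :=
  (basisV n).constr (L n) fun c =>
    ∑ d : Fin 2 × Fin 2,
      (⟨rEntry (lam n - ((∑ s ∈ S, hWeight (c s) : ℤ) : RatFun n) * y n) (z n i - z n j) (y n)
          d (c p, c q), rEntry_mem n _ i j _ _⟩ : L n) •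
        basisV n (Function.update (Function.update c p d.1) q d.2)

end

end DynStab

namespace DynStab

noncomputable section

/-! ### Splitting of commuting roots over a ring where the points are separated -/

/-! The argument works throughout with restrictions to fixed points. Over `L n` localization is an
isomorphism (`locX_bijective`): a class is determined by its restrictions, and these may be
prescribed arbitrarily.

Surjectivity is Lagrange interpolation, since the differences of the `z i` are units. For
injectivity, adjoin the Chern roots to the cohomology ring. Each root satisfies ∏(u - zᵢ) = 0, whose
roots are separated, so the enlarged ring splits into pieces on which every Chern root equals some
zᵢ. Pieces that miss some zᵢ vanish; on the others a class equals its restriction to a fixed point.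
Averaging over S_k × S_{n-k} shows that adjoining the roots loses nothing
(`eq_zero_of_fixedPoints`).

Existence and uniqueness of κ_{σ,I} then only require the prescribed values to lie in `L n`.
Bijectivity of Stab_σ becomes invertibility of the matrix of restrictions. This matrix is triangular
because W_I at z_J vanishes unless J, suitably ordered, lies termwise at or below I; its diagonal
entries are units.

The R-matrix formula becomes Stab_{σs} ∘ R = Stab_σ, read at every fixed point. If exactly one of
the two adjacent positions lies in the subset, the relation holds summand by summand before
symmetrization (`normWeight_exchange`). If both or neither do, R acts as 1, and what is needed is
symmetry of W_I in the two corresponding z's (`weight_comp_swap`). The dynamical shift is the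
integer `w`, which is itself a sum of weights ±1 over later positions. -/

theorem exists_orthogonal_decomposition {Q G : Type*} [CommRing Q] [Fintype G] [DecidableEq G]
    {n : ℕ} (γ : G → Q) (x : Fin n → Q) (hx : ∀ i j, i ≠ j → IsUnit (x i - x j))
    (hrel : ∏ g, (Polynomial.X - Polynomial.C (γ g)) = ∏ i, (Polynomial.X - Polynomial.C (x i))) :
    ∃ ε : (G → Fin n) → Q, ∑ φ, ε φ = 1 ∧ (∀ φ g, γ g * ε φ = x (φ g) * ε φ) ∧
      ∀ φ, ¬ Function.Surjective φ → ε φ = 0 := by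
  have heval (u : Q) : ∏ g, (u - γ g) = ∏ i, (u - x i) := by
    simpa [Polynomial.eval_prod] using congrArg (Polynomial.eval u) hrel
  have hroot (g : G) : ∏ i, (γ g - x i) = 0 := by
    rw [← heval]
    exact Finset.prod_eq_zero (Finset.mem_univ g) (sub_self _)
  -- Partition of unity for each root: the products omitting one factor `γ g - x i` generate the
  -- unit ideal, because the factors are pairwise coprime.
  have hμ (g : G) : ∃ μ : Fin n → Q, ∑ i, μ i * ∏ j ∈ {i}ᶜ, (γ g - x j) = 1 := by
    -- Without points, `hroot` reads 1 = 0, so the ring is trivial.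
    rcases isEmpty_or_nonempty (Fin n) with hn | hn
    · have h0 := hroot g
      rw [Fintype.prod_empty] at h0
      exact ⟨fun _ => 0, by rw [h0]; simp⟩
    · refine exists_sum_eq_one_iff_pairwise_coprime'.2 fun i j hij => ?_
      obtain ⟨v, hv⟩ := hx j i hij.symm
      refine ⟨(v⁻¹ : Qˣ), -(v⁻¹ : Qˣ), ?_⟩
      linear_combination (v⁻¹ : Qˣ).1 * (-hv) + v.inv_mul
  choose μ hμ using hμ
  set E : G → Fin n → Q := fun g i => μ g i * ∏ j ∈ {i}ᶜ, (γ g - x j) with hE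
  have hmul (g : G) (i : Fin n) : γ g * E g i = x i * E g i := by
    have h1 : (γ g - x i) * ∏ j ∈ {i}ᶜ, (γ g - x j) = 0 := by
      rw [← hroot g, ← Finset.prod_mul_prod_compl {i}, Finset.prod_singleton]
    simp only [hE]
    linear_combination μ g i * h1
  have hmulε (φ : G → Fin n) (g : G) : γ g * ∏ g, E g (φ g) = x (φ g) * ∏ g, E g (φ g) := by
    rw [← Finset.mul_prod_erase _ _ (Finset.mem_univ g), ← mul_assoc, hmul, mul_assoc]
  refine ⟨fun φ => ∏ g, E g (φ g), ?_, hmulε, fun φ hφ => ?_⟩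
  · rw [← Fintype.prod_sum]
    exact Finset.prod_eq_one fun g _ => hμ g
  · have hsub (s : Finset G) (u : Q) : (∏ g ∈ s, (u - γ g)) * ∏ g, E g (φ g) =
        (∏ g ∈ s, (u - x (φ g))) * ∏ g, E g (φ g) := by
      induction s using Finset.induction_on with
      | empty => rfl
      | insert g s hg ih =>
        rw [Finset.prod_insert hg, Finset.prod_insert hg, mul_assoc, ih, mul_assoc]
        linear_combination -(∏ g ∈ s, (u - x (φ g))) * hmulε φ g
    obtain ⟨i, hi⟩ : ∃ i, ∀ g, φ g ≠ i := by simpa [Function.Surjective] using hφ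
    -- At a missed point `x i`, ∏(u - γ) vanishes by the relation, while on the piece `φ` it acts as
    -- a product of units; hence the piece is zero.
    have h1 := hsub Finset.univ (x i)
    rw [heval, Finset.prod_eq_zero (Finset.mem_univ i) (sub_self _), zero_mul] at h1
    exact ((IsUnit.prod_univ_iff.2 fun g => hx i (φ g) (hi g).symm).mul_right_eq_zero).1 h1.symm

/-! ### The Reynolds operator -/

section Reynolds

variable {A : Type*} [CommRing A] [Algebra ℚ A] (n k : ℕ)

/-- Averaging over `S_k × S_{n-k}`. -/
def reynolds : MvPolynomial (Roots n k) A →ₗ[symPol A n k] symPol A n k where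
  toFun p := ⟨(Fintype.card (Equiv.Perm (Fin k) × Equiv.Perm (Fin (n - k))) : ℚ)⁻¹ •
      ∑ g : Equiv.Perm (Fin k) × Equiv.Perm (Fin (n - k)),
        MvPolynomial.rename (Equiv.sumCongr g.1 g.2) p, fun s t => by
    rw [map_rat_smul, map_sum]
    congr 1
    refine Fintype.sum_equiv (Equiv.mulLeft (s, t)) _ _ fun g => ?_
    rw [MvPolynomial.rename_rename]
    congr 2
    ext (i | i) <;> rfl⟩
  map_add' p q := Subtype.ext <| by simp [Finset.sum_add_distrib]
  map_smul' f p := Subtype.ext <| by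
    have h (g : Equiv.Perm (Fin k) × Equiv.Perm (Fin (n - k))) :
        MvPolynomial.rename (Equiv.sumCongr g.1 g.2) (f • p) =
          f • MvPolynomial.rename (Equiv.sumCongr g.1 g.2) p := by
      rw [Subalgebra.smul_def, Subalgebra.smul_def, smul_eq_mul, smul_eq_mul, map_mul, f.2]
    simp only [h, ← Finset.smul_sum, RingHom.id_apply]
    rw [smul_comm]
    rfl

theorem reynolds_one : reynolds (A := A) n k 1 = 1 := Subtype.ext <| by
  change (_ : ℚ) • ∑ g : Equiv.Perm (Fin k) × Equiv.Perm (Fin (n - k)), _ = 1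
  simp only [map_one, Finset.sum_const, Finset.card_univ]
  rw [← Nat.cast_smul_eq_nsmul ℚ, smul_smul, inv_mul_cancel₀, one_smul]
  exact Nat.cast_ne_zero.2 Fintype.card_ne_zero

end Reynolds

/-- Tensoring the retraction with `T` gives a left inverse, so no flatness is needed. It is applied
with `P` the polynomials in the Chern roots and `S` the invariants. -/
theorem includeLeft_injective_of_retraction {S P T : Type*} [CommRing S] [CommRing P] [CommRing T]
    [Algebra S P] [Algebra S T] (ρ : P →ₗ[S] S) (hρ : ρ 1 = 1) :
    Function.Injective (algebraMap T (T ⊗[S] P)) := by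
  refine Function.LeftInverse.injective
    (g := (TensorProduct.rid S T) ∘ (LinearMap.lTensor T ρ)) fun t => ?_
  simp [Algebra.TensorProduct.algebraMap_apply, hρ]

/-! ### Substitutions at fixed points -/

theorem exists_perm_orderEmbOfFin {n k : ℕ} {J : Finset (Fin n)} (hJ : J.card = k)
    {f : Fin k → Fin n} (hf : Function.Injective f) (hfJ : ∀ r, f r ∈ J) :
    ∃ s : Equiv.Perm (Fin k), ∀ r, J.orderEmbOfFin hJ (s r) = f r := by
  have h1 (r : Fin k) : ∃ q, J.orderEmbOfFin hJ q = f r :=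
    (Set.ext_iff.1 (J.range_orderEmbOfFin hJ) (f r)).2 (hfJ r)
  choose s hs using h1
  have hsinj : Function.Injective s := fun a b hab => hf (by rw [← hs, ← hs, hab])
  exact ⟨Equiv.ofBijective s (Finite.injective_iff_bijective.1 hsinj), hs⟩

section Subst

variable {A : Type*} [CommRing A] {n k : ℕ}

/-- The fixed point determined by a bijective placement of the Chern roots. -/
theorem exists_subst_eq_aeval (x : Fin n → A) (φ : Roots n k → Fin n)
    (hφ : Function.Bijective φ) :
    ∃ (J : Finset (Fin n)) (hJ : J.card = k), ∀ p ∈ symPol A n k,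
      subst x J hJ p = MvPolynomial.aeval (x ∘ φ) p := by
  classical
  have hl : Function.Injective fun r : Fin k => φ (Sum.inl r) :=
    hφ.injective.comp Sum.inl_injective
  have hr : Function.Injective fun r : Fin (n - k) => φ (Sum.inr r) :=
    hφ.injective.comp Sum.inr_injective
  set J : Finset (Fin n) := Finset.univ.image fun r : Fin k => φ (Sum.inl r) with hJdef
  have hJ : J.card = k := by
    rw [hJdef, Finset.card_image_of_injective _ hl, Finset.card_univ, Fintype.card_fin]
  obtain ⟨s, hs⟩ := exists_perm_orderEmbOfFin hJ hl fun r => Finset.mem_image_of_mem _ (Finset.mem_univ r)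
  obtain ⟨t, ht⟩ := exists_perm_orderEmbOfFin (card_compl_eq J hJ) hr fun r => by
    simp [hJdef, hφ.injective.eq_iff]
  refine ⟨J, hJ, fun p hp => ?_⟩
  conv_lhs => rw [← hp s t]
  rw [subst, MvPolynomial.aeval_rename]
  congr 2
  ext (r | r)
  · simp [rootAt, hs]
  · simp [rootAt, ht]

end Subst

/-- Abstract form of injectivity of localization: `T` plays the cohomology ring with coefficients
extended to `B`, and `ψ` sends an invariant polynomial to its class. Individual Chern roots do not
exist in `T`, so the splitting takes place in `Q`, where they do. -/
theorem eq_zero_of_fixedPoints {A B T : Type*} [CommRing A] [CommRing B] [CommRing T] [Algebra ℚ A]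
    [Algebra A B] [Algebra B T] {n k : ℕ} (x : Fin n → A)
    (hx : ∀ i j, i ≠ j → IsUnit (algebraMap A B (x i) - algebraMap A B (x j))) (hk : k ≤ n)
    (ψ : symPol A n k →+* T)
    (hψC : ∀ a, ψ (algebraMap A (symPol A n k) a) = algebraMap B T (algebraMap A B a))
    (hψ0 : ∀ m, ψ ⟨(relPol x k).coeff m, relPol_coeff_mem x k m⟩ = 0)
    (ev : ∀ J : Finset (Fin n), J.card = k → T →ₐ[B] B)
    (hev : ∀ J hJ s, ev J hJ (ψ s) = algebraMap A B (subst x J hJ s.1))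
    (hspan : ∀ h, h ∈ Submodule.span B (Set.range ψ)) (h : T) (hh : ∀ J hJ, ev J hJ h = 0) :
    h = 0 := by
  let : Algebra (symPol A n k) T := ψ.toAlgebra
  set Q := T ⊗[symPol A n k] MvPolynomial (Roots n k) A
  let ι : T →+* Q := algebraMap T Q
  let ιB : B →+* Q := ι.comp (algebraMap B T)
  let ofP : MvPolynomial (Roots n k) A →+* Q :=
    (Algebra.TensorProduct.includeRight : MvPolynomial (Roots n k) A →ₐ[symPol A n k] Q).toRingHom
  have hι : Function.Injective ι :=
    includeLeft_injective_of_retraction (reynolds n k) (reynolds_one n k)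
  have hofS (s : symPol A n k) : ofP s.1 = ι (ψ s) := by
    change (1 : T) ⊗ₜ[symPol A n k] s.1 = ψ s ⊗ₜ[symPol A n k] 1
    have h1 : s.1 = s • (1 : MvPolynomial (Roots n k) A) := (mul_one _).symm
    have h2 : ψ s = s • (1 : T) := (mul_one _).symm
    rw [h1, h2, TensorProduct.smul_tmul]
  have hofC (a : A) : ofP (MvPolynomial.C a) = ιB (algebraMap A B a) := by
    have := hofS (algebraMap A (symPol A n k) a)
    rw [hψC] at this
    exact this
  have hrel : ∏ g : Roots n k, (Polynomial.X - Polynomial.C (ofP (MvPolynomial.X g))) =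
      ∏ i, (Polynomial.X - Polynomial.C (ιB (algebraMap A B (x i)))) := by
    have h1 : (relPol x k).map ofP = 0 := by
      ext m
      rw [Polynomial.coeff_map, Polynomial.coeff_zero]
      refine (hofS ⟨_, relPol_coeff_mem x k m⟩).trans ?_
      rw [hψ0, map_zero]
    rw [← sub_eq_zero, ← h1, Fintype.prod_sum_type, relPol]
    simp only [Polynomial.map_sub, Polynomial.map_mul, Polynomial.map_prod, Polynomial.map_X,
      Polynomial.map_C, hofC]
  obtain ⟨ε, hε1, hεγ, hε0⟩ := exists_orthogonal_decomposition
    (fun g : Roots n k => ofP (MvPolynomial.X g)) (fun i => ιB (algebraMap A B (x i)))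
    (fun i j hij => by rw [← map_sub]; exact (hx i j hij).map ιB) hrel
  have hP (p : MvPolynomial (Roots n k) A) (φ : Roots n k → Fin n) :
      ofP p * ε φ = ιB (algebraMap A B (MvPolynomial.aeval (x ∘ φ) p)) * ε φ := by
    induction p using MvPolynomial.induction_on with
    | C a => rw [hofC, MvPolynomial.aeval_C, Algebra.algebraMap_self, RingHom.id_apply]
    | add p q hp hq => simp only [map_add, add_mul, hp, hq]
    | mul_X p g hp =>
      simp only [map_mul, MvPolynomial.aeval_X]
      rw [mul_assoc, hεγ, mul_left_comm, hp]
      simp only [Function.comp_apply]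
      ring
  apply hι
  rw [map_zero, ← mul_one (ι h), ← hε1, Finset.mul_sum]
  refine Finset.sum_eq_zero fun φ _ => ?_
  -- A surjective placement is bijective by cardinality (here `k ≤ n` enters) and so defines a fixed
  -- point.
  by_cases hφ : Function.Surjective φ
  · have hbij : Function.Bijective φ :=
      (Fintype.bijective_iff_surjective_and_card φ).2 ⟨hφ, by simp [hk]⟩
    obtain ⟨J, hJ, hs⟩ := exists_subst_eq_aeval x φ hbij
    -- Both sides are `B`-linear in `h`, so it suffices to compare them on classes of invariant
    -- polynomials.
    have key : ι h * ε φ = ιB (ev J hJ h) * ε φ := by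
      refine Submodule.span_induction (p := fun h _ => ι h * ε φ = ιB (ev J hJ h) * ε φ)
        ?_ ?_ ?_ ?_ (hspan h)
      · rintro _ ⟨s, rfl⟩
        rw [hev, hs _ s.2, ← hP, hofS]
      · simp only [map_zero]
      · intro f g _ _ hf hg
        simp only [map_add, add_mul, hf, hg]
      · intro b f _ hf
        rw [Algebra.smul_def, map_mul (ev J hJ), AlgHom.commutes, map_mul ι, map_mul ιB,
          mul_assoc, mul_assoc, hf]
        rfl
    rw [key, hh, map_zero, zero_mul]
  · rw [hε0 φ hφ, mul_zero]

/-! ### Nonzero elements and units of the coefficient ring -/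

section Coefficients

variable (n : ℕ)

theorem algebraMap_pol_injective : Function.Injective (algebraMap (Pol n) (RatFun n)) := by
  rw [IsScalarTower.algebraMap_eq (Pol n) (Polynomial (Pol n)) (RatFun n), RingHom.coe_comp]
  exact (IsFractionRing.injective (Polynomial (Pol n)) (RatFun n)).comp Polynomial.C_injective

theorem z_injective : Function.Injective (z n) := fun i j h => by
  have := MvPolynomial.X_injective (algebraMap_pol_injective n h)
  exact Option.some_injective _ this

theorem z_sub_ne_zero {i j : Fin n} (h : i ≠ j) : z n i - z n j ≠ 0 :=
  sub_ne_zero.2 ((z_injective n).ne h)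

theorem z_sub_z_sub_y_ne_zero (i j : Fin n) : z n i - z n j - y n ≠ 0 := by
  have h : z n i - z n j - y n = algebraMap (Pol n) (RatFun n) (polZ n i - polZ n j - polY n) := by
    simp [z, y]
  rw [h]
  refine (map_ne_zero_iff _ (algebraMap_pol_injective n)).2 fun h0 => ?_
  -- The point z = 0, y = 1 works for all `i`, `j`, including `i = j`.
  have := congrArg (MvPolynomial.eval fun o : Option (Fin n) => if o = none then (1 : ℂ) else 0) h0
  simp [polZ, polY] at this

theorem lam_sub_ne_zero (l : ℤ) : lam n - (l : RatFun n) * y n ≠ 0 := by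
  have h : lam n - (l : RatFun n) * y n = algebraMap (Polynomial (Pol n)) (RatFun n)
      (Polynomial.X - Polynomial.C ((l : Pol n) * polY n)) := by
    simp only [map_sub, map_mul, lam, y, map_intCast]
    rw [IsScalarTower.algebraMap_apply (Pol n) (Polynomial (Pol n)) (RatFun n)]
    rfl
  rw [h]
  exact (map_ne_zero_iff _ (IsFractionRing.injective _ _)).2 (Polynomial.X_sub_C_ne_zero _)

theorem inv_z_sub_mem {i j : Fin n} (h : i ≠ j) : (z n i - z n j)⁻¹ ∈ ringL n :=
  (le_sup_right : ringZY n ≤ ringL n) (Algebra.subset_adjoin (Or.inl ⟨i, j, h, rfl⟩))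

/-- The rational functions that are units of `𝓛_{λ,z,y}`. -/
def unitsL : Submonoid (RatFun n) where
  carrier := {f | f ≠ 0 ∧ f ∈ ringL n ∧ f⁻¹ ∈ ringL n}
  one_mem' := ⟨one_ne_zero, one_mem _, by rw [inv_one]; exact one_mem _⟩
  mul_mem' {f g} hf hg := ⟨mul_ne_zero hf.1 hg.1, mul_mem hf.2.1 hg.2.1, by
    rw [mul_inv]; exact mul_mem hf.2.2 hg.2.2⟩

variable {n}

theorem inv_mem_unitsL {f : RatFun n} (hf : f ∈ unitsL n) : f⁻¹ ∈ unitsL n :=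
  ⟨inv_ne_zero hf.1, hf.2.2, by rw [inv_inv]; exact hf.2.1⟩

theorem div_mem_unitsL {f g : RatFun n} (hf : f ∈ unitsL n) (hg : g ∈ unitsL n) :
    f / g ∈ unitsL n := by
  rw [div_eq_mul_inv]
  exact mul_mem hf (inv_mem_unitsL hg)

theorem neg_mem_unitsL {f : RatFun n} (hf : f ∈ unitsL n) : -f ∈ unitsL n :=
  ⟨neg_ne_zero.2 hf.1, neg_mem hf.2.1, by
    rw [show (-f)⁻¹ = -f⁻¹ from inv_neg]
    exact neg_mem hf.2.2⟩

theorem isUnit_of_mem_unitsL {f : L n} (hf : (f : RatFun n) ∈ unitsL n) : IsUnit f :=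
  IsUnit.of_mul_eq_one (⟨(f : RatFun n)⁻¹, hf.2.2⟩ : L n) (Subtype.ext (mul_inv_cancel₀ hf.1))

theorem z_sub_mem_unitsL {i j : Fin n} (h : i ≠ j) : z n i - z n j ∈ unitsL n :=
  ⟨z_sub_ne_zero n h, sub_mem (z_mem n i) (z_mem n j), inv_z_sub_mem n h⟩

theorem z_sub_add_mem_unitsL (i j : Fin n) : z n i - z n j + y n ∈ unitsL n := by
  have h : z n i - z n j + y n = -(z n j - z n i - y n) := by ring
  rw [h]
  exact neg_mem_unitsL ⟨z_sub_z_sub_y_ne_zero n j i,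
    sub_mem (sub_mem (z_mem n j) (z_mem n i)) (y_mem n), inv_z_mem n j i⟩

theorem lam_sub_mem_unitsL (l : ℤ) : lam n - (l : RatFun n) * y n ∈ unitsL n :=
  ⟨lam_sub_ne_zero n l, sub_mem (lam_mem n) (mul_mem (intCast_mem _ l) (y_mem n)), inv_lam_mem n l⟩

end Coefficients

/-! ### Equivariant localization is an isomorphism over `𝓛_{λ,z,y}` -/

section Localization

variable {n k : ℕ}

/-- The element `zᵢ` of `𝓛_{λ,z,y}`. -/
def zL (n : ℕ) (i : Fin n) : L n := algebraMap (Pol n) (L n) (polZ n i)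

theorem isUnit_zL_sub {i j : Fin n} (h : i ≠ j) : IsUnit (zL n i - zL n j) :=
  isUnit_of_mem_unitsL (z_sub_mem_unitsL h)

/-- The class in `H_T^*(T^*Gr_k(ℂⁿ))` of an invariant polynomial. -/
def symToH (n k : ℕ) : symPol (Pol n) n k →+* H n k :=
  Ideal.Quotient.mk (relIdeal (polZ n) k)

theorem symToH_surjective (n k : ℕ) : Function.Surjective (symToH n k) :=
  Ideal.Quotient.mk_surjective

theorem symToH_coeff (m : ℕ) :
    symToH n k ⟨(relPol (polZ n) k).coeff m, relPol_coeff_mem (polZ n) k m⟩ = 0 :=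
  Ideal.Quotient.eq_zero_iff_mem.2 (Ideal.subset_span (Set.mem_range_self m))

/-- The class in `H_T^*(T^*Gr_k(ℂⁿ)) ⊗ 𝓛_{λ,z,y}` of an invariant polynomial. -/
def symToHL (n k : ℕ) : symPol (Pol n) n k →+* HL n k :=
  (Algebra.TensorProduct.includeRight : H n k →ₐ[Pol n] L n ⊗[Pol n] H n k).toRingHom.comp
    (symToH n k)

theorem symToHL_algebraMap (a : Pol n) :
    symToHL n k (algebraMap (Pol n) (symPol (Pol n) n k) a) =
      algebraMap (L n) (HL n k) (algebraMap (Pol n) (L n) a) :=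
  ((Algebra.TensorProduct.includeRight : H n k →ₐ[Pol n] L n ⊗[Pol n] H n k).commutes a)

theorem symToHL_coeff (m : ℕ) :
    symToHL n k ⟨(relPol (polZ n) k).coeff m, relPol_coeff_mem (polZ n) k m⟩ = 0 := by
  exact (congrArg (Algebra.TensorProduct.includeRight : H n k →ₐ[Pol n] L n ⊗[Pol n] H n k)
    (symToH_coeff m)).trans (map_zero _)

theorem HL_induction {P : HL n k → Prop} (h : HL n k)
    (hmul : ∀ (l : L n) (s : symPol (Pol n) n k), P (algebraMap (L n) (HL n k) l * symToHL n k s))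
    (hadd : ∀ f g, P f → P g → P (f + g)) : P h := by
  refine TensorProduct.induction_on (motive := P) h ?_ (fun l f => ?_) hadd
  · have := hmul 0 0
    rwa [map_zero, map_zero, zero_mul] at this
  · obtain ⟨s, rfl⟩ := symToH_surjective n k f
    have h1 : algebraMap (L n) (HL n k) l * symToHL n k s = l ⊗ₜ[Pol n] symToH n k s := by
      change (l ⊗ₜ[Pol n] (1 : H n k)) * ((1 : L n) ⊗ₜ[Pol n] symToH n k s) = _
      rw [Algebra.TensorProduct.tmul_mul_tmul, mul_one, one_mul]
    rw [← h1]
    exact hmul l s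

theorem locL_symToHL (J : Finset (Fin n)) (hJ : J.card = k) (s : symPol (Pol n) n k) :
    locL J hJ (symToHL n k s) = algebraMap (Pol n) (L n) (subst (polZ n) J hJ s.1) := by
  change Algebra.TensorProduct.lift _ _ _ ((1 : L n) ⊗ₜ[Pol n] _) = _
  rw [Algebra.TensorProduct.lift_tmul, map_one, one_mul]
  rfl

theorem eq_zero_of_forall_locL (hk : k ≤ n) (h : HL n k)
    (hh : ∀ (J : Finset (Fin n)) (hJ : J.card = k), locL J hJ h = 0) : h = 0 :=
  eq_zero_of_fixedPoints (polZ n) (fun _ _ hij => isUnit_zL_sub hij) hk (symToHL n k)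
    symToHL_algebraMap symToHL_coeff (fun J hJ => locL J hJ) locL_symToHL
    (fun f => HL_induction f (fun l s => by
        rw [← Algebra.smul_def]
        exact Submodule.smul_mem _ _ (Submodule.subset_span ⟨s, rfl⟩))
      fun _ _ hf hg => add_mem hf hg) h hh

/-- The invariant polynomial `∏_{a ∉ J} ∏_r (z_a - γ_{1,r})`. -/
def fixedPointPol (J : Finset (Fin n)) (k : ℕ) : symPol (Pol n) n k :=
  ⟨∏ a ∈ Jᶜ, ∏ r : Fin k, (MvPolynomial.C (polZ n a) - MvPolynomial.X (Sum.inl r)), fun s t => by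
    simp only [map_prod, map_sub, MvPolynomial.rename_C, MvPolynomial.rename_X,
      Equiv.sumCongr_apply, Sum.map_inl]
    exact Finset.prod_congr rfl fun a _ => Equiv.prod_comp s fun r =>
      (MvPolynomial.C (polZ n a) - MvPolynomial.X (Sum.inl r) :
        MvPolynomial (Roots n k) (Pol n))⟩

/-- This value is zero unless `J' ⊆ J`, hence for equal cardinalities unless `J' = J`, where it is a
unit. The classes are therefore Lagrange interpolants for the fixed points. -/
theorem locL_fixedPointPol (J J' : Finset (Fin n)) (hJ' : J'.card = k) :
    locL J' hJ' (symToHL n k (fixedPointPol J k)) =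
      ∏ a ∈ Jᶜ, ∏ b ∈ J', (zL n a - zL n b) := by
  rw [locL_symToHL]
  simp only [fixedPointPol, subst, map_prod, map_sub, MvPolynomial.aeval_C, MvPolynomial.aeval_X,
    rootAt, Sum.elim_inl, Algebra.algebraMap_self, RingHom.id_apply]
  exact Finset.prod_congr rfl fun a _ => prod_orderEmb J' hJ' fun b => zL n a - zL n b

theorem exists_locL_eq (k : ℕ) (v : Finset (Fin n) → L n) :
    ∃ h : HL n k, ∀ (J : Finset (Fin n)) (hJ : J.card = k), locL J hJ h = v J := by
  have hu (J : Finset (Fin n)) : IsUnit (∏ a ∈ Jᶜ, ∏ b ∈ J, (zL n a - zL n b)) :=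
    IsUnit.prod_iff.2 fun a ha => IsUnit.prod_iff.2 fun b hb =>
      isUnit_zL_sub fun h => Finset.mem_compl.1 ha (h ▸ hb)
  choose u hu using hu
  refine ⟨∑ J ∈ Finset.univ.filter (fun J : Finset (Fin n) => J.card = k),
    algebraMap (L n) (HL n k) (v J * (u J)⁻¹.1) * symToHL n k (fixedPointPol J k), fun J hJ => ?_⟩
  rw [map_sum, Finset.sum_eq_single J]
  · rw [map_mul (locL J hJ), AlgHom.commutes, locL_fixedPointPol, ← hu, Algebra.algebraMap_self,
      RingHom.id_apply, mul_assoc, Units.inv_mul, mul_one]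
  · intro K hK hKJ
    rw [map_mul (locL J hJ), locL_fixedPointPol]
    have : ¬ J ⊆ K := fun h => hKJ
      (Finset.eq_of_subset_of_card_le h (by rw [hJ, (Finset.mem_filter.1 hK).2])).symm
    obtain ⟨a, ha, haK⟩ := Finset.not_subset.1 this
    rw [Finset.prod_eq_zero (Finset.mem_compl.2 haK) (Finset.prod_eq_zero ha (sub_self _)),
      mul_zero]
  · intro h
    exact absurd (Finset.mem_filter.2 ⟨Finset.mem_univ J, hJ⟩) h

/-- Localization to all fixed points of `𝓧ₙ`. -/
def locX (n : ℕ) : HX n →ₗ[L n] (Finset (Fin n) → L n) :=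
  LinearMap.pi fun J => (locL (k := J.card) J rfl).toLinearMap ∘ₗ
    LinearMap.proj (⟨J.card, Nat.lt_succ_of_le (card_finset_fin_le J)⟩ : Fin (n + 1))

theorem locX_apply (f : HX n) (J : Finset (Fin n)) :
    locX n f J = locL J rfl (f ⟨J.card, Nat.lt_succ_of_le (card_finset_fin_le J)⟩) := rfl

theorem locX_bijective (n : ℕ) : Function.Bijective (locX n) := by
  constructor
  · refine (injective_iff_map_eq_zero _).2 fun f hf => funext fun k => ?_
    refine eq_zero_of_forall_locL (Nat.lt_succ_iff.1 k.2) _ fun J hJ => ?_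
    obtain ⟨k, hk⟩ := k
    obtain rfl : J.card = k := hJ
    exact congrFun hf J
  · intro v
    choose h hh using fun k : Fin (n + 1) => exists_locL_eq (k : ℕ) v
    exact ⟨h, funext fun J => (locX_apply h J).trans (hh ⟨J.card, _⟩ J rfl)⟩

end Localization

/-! ### Adjacent transpositions and the combinatorics of subsets -/

section Adjacent

variable {n : ℕ} {a b : Fin n}

/-- An adjacent transposition reverses the order of the pair (a, b) only. -/
theorem swap_lt_swap (hab : (b : ℕ) = a + 1) {x y : Fin n} (h : x < y) (hne : ¬(x = a ∧ y = b)) :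
    Equiv.swap a b x < Equiv.swap a b y := by
  simp only [Equiv.swap_apply_def]
  simp only [Fin.ext_iff, Fin.lt_def] at *
  split_ifs <;> omega

theorem swap_lt_iff (hab : (b : ℕ) = a + 1) {i c : Fin n} (hib : i ≠ b) :
    Equiv.swap a b c < i ↔ c < i := by
  simp only [Equiv.swap_apply_def]
  simp only [Fin.lt_def, ne_eq, Fin.ext_iff] at *
  split_ifs <;> omega

theorem mem_preim {σ : Equiv.Perm (Fin n)} {I : Finset (Fin n)} {i : Fin n} :
    i ∈ preim σ I ↔ σ i ∈ I := by
  simp [preim, Finset.mem_map_equiv]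

theorem preim_mul (σ τ : Equiv.Perm (Fin n)) (I : Finset (Fin n)) :
    preim (σ * τ) I = preim τ (preim σ I) := by
  ext i
  simp [mem_preim]

theorem preim_injective (σ : Equiv.Perm (Fin n)) : Function.Injective (preim σ) :=
  Finset.map_injective _

theorem preim_swap_eq_self {I : Finset (Fin n)} (h : a ∈ I ↔ b ∈ I) :
    preim (Equiv.swap a b) I = I := by
  ext i
  rw [mem_preim, Equiv.swap_apply_def]
  split_ifs with h1 h2
  · rw [h1, h]
  · rw [h2, h]
  · rfl

/-- If `a` and `b` are not both in `I`, the swap is increasing on `I`, so it carries the increasing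
enumeration to the increasing enumeration. -/
theorem orderEmbOfFin_preim_swap (hab : (b : ℕ) = a + 1) {I : Finset (Fin n)} {k : ℕ}
    (hI : I.card = k) (h : ¬(a ∈ I ∧ b ∈ I)) (r : Fin k) :
    (preim (Equiv.swap a b) I).orderEmbOfFin (card_preim _ hI) r =
      Equiv.swap a b (I.orderEmbOfFin hI r) := by
  refine (congrFun (Finset.orderEmbOfFin_unique (card_preim _ hI)
    (f := fun r => Equiv.swap a b (I.orderEmbOfFin hI r)) (fun r => ?_) fun r r' hr => ?_) r).symm
  · rw [mem_preim, Equiv.swap_apply_self]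
    exact I.orderEmbOfFin_mem hI r
  · refine swap_lt_swap hab ((I.orderEmbOfFin hI).strictMono hr) fun h' => h ?_
    rw [← h'.1, ← h'.2]
    exact ⟨I.orderEmbOfFin_mem hI r, I.orderEmbOfFin_mem hI r'⟩

theorem exists_orderEmbOfFin_eq {I : Finset (Fin n)} {k : ℕ} (hI : I.card = k) {i : Fin n}
    (hi : i ∈ I) : ∃ r, I.orderEmbOfFin hI r = i :=
  (Set.ext_iff.1 (I.range_orderEmbOfFin hI) i).2 hi

theorem w_eq_sum (i : Fin n) (I : Finset (Fin n)) :
    w i I = ∑ j ∈ Finset.univ.filter (fun j => i < j), (if j ∈ I then 1 else -1 : ℤ) := by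
  rw [Finset.sum_ite, Finset.filter_filter, Finset.filter_filter, w, add_comm]
  simp

/-- `w i` only sees the set of positions beyond `i`, and the swap preserves that set unless `i = a`.
-/
theorem w_preim_swap (hab : (b : ℕ) = a + 1) {i : Fin n} (hia : i ≠ a) (I : Finset (Fin n)) :
    w i (preim (Equiv.swap a b) I) = w i I := by
  rw [w_eq_sum, w_eq_sum]
  refine Finset.sum_nbij' (Equiv.swap a b) (Equiv.swap a b) ?_ ?_ (fun _ _ => by simp)
    (fun _ _ => by simp) (fun j _ => by simp only [mem_preim])
  all_goals
    intro j hj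
    simp only [Finset.mem_filter, Finset.mem_univ, true_and] at hj ⊢
    rw [Equiv.swap_apply_def]
    simp only [Fin.lt_def, ne_eq, Fin.ext_iff] at *
    split_ifs <;> omega

theorem w_adjacent (hab : (b : ℕ) = a + 1) (I : Finset (Fin n)) :
    w a I = w b I + if b ∈ I then 1 else -1 := by
  have h : Finset.univ.filter (fun j => a < j) =
      insert b (Finset.univ.filter fun j => b < j) := by
    ext j
    simp only [Finset.mem_filter, Finset.mem_univ, true_and, Finset.mem_insert, Fin.lt_def,
      Fin.ext_iff]
    omega
  rw [w_eq_sum, w_eq_sum, h, Finset.sum_insert (by simp), add_comm]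

end Adjacent

/-! ### Factorizations of the weight functions -/

section WeightFactors

variable {F : Type*} [Field F] {n k : ℕ} {a b : Fin n}

/-- The product of the factors of a weight function that involve one of its variables `t`. -/
def rowFactor (I : Finset (Fin n)) (i : Fin n) (lam t : F) (z : Fin n → F) (y : F) : F :=
  ∏ c, lFactor I i c lam t z y

/-- A row depends on the subset only through `w i`. -/
theorem rowFactor_preim_swap (hab : (b : ℕ) = a + 1) {i : Fin n} (hia : i ≠ a)
    (I : Finset (Fin n)) (lam t : F) (z : Fin n → F) (y : F) :
    rowFactor (preim (Equiv.swap a b) I) i lam t z y = rowFactor I i lam t z y := by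
  simp only [rowFactor, lFactor, w_preim_swap hab hia]

/-- Adjacent positions lie on the same side of any other `i`, so their two factors have the same
shape and are merely interchanged. -/
theorem rowFactor_comp_swap (hab : (b : ℕ) = a + 1) {i : Fin n} (hia : i ≠ a) (hib : i ≠ b)
    (I : Finset (Fin n)) (lam t : F) (z : Fin n → F) (y : F) :
    rowFactor I i lam t (z ∘ Equiv.swap a b) y = rowFactor I i lam t z y := by
  rw [rowFactor, rowFactor, ← Equiv.prod_comp (Equiv.swap a b)]
  refine Finset.prod_congr rfl fun c _ => ?_
  have hc : Equiv.swap a b c = i ↔ c = i := by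
    rw [Equiv.swap_apply_eq_iff, Equiv.swap_apply_of_ne_of_ne hia hib]
  simp only [lFactor, swap_lt_iff hab hib, hc, Function.comp_apply, Equiv.swap_apply_self]

/-- The factors shared by the rows of two adjacent elements `a, b`. -/
def commonFactor (a b : Fin n) (t : F) (z : Fin n → F) (y : F) : F :=
  ∏ c ∈ (Finset.univ.erase a).erase b, if c < a then t - z c + y else t - z c

theorem commonFactor_comp_swap (t : F) (z : Fin n → F) (y : F) :
    commonFactor a b t (z ∘ Equiv.swap a b) y = commonFactor a b t z y := by
  refine Finset.prod_congr rfl fun c hc => ?_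
  simp only [Finset.mem_erase] at hc
  rw [Function.comp_apply, Equiv.swap_apply_of_ne_of_ne hc.2.1 hc.1]

theorem rowFactor_left (hab : (b : ℕ) = a + 1) (I : Finset (Fin n)) (lam t : F) (z : Fin n → F)
    (y : F) : rowFactor I a lam t z y =
      commonFactor a b t z y * ((lam + t - z a - (w a I : F) * y) * (t - z b)) := by
  have hne : b ≠ a := fun h => by rw [h] at hab; omega
  have hlt : ¬ b < a := by rw [Fin.lt_def]; omega
  rw [rowFactor, ← Finset.mul_prod_erase _ _ (Finset.mem_univ a),
    ← Finset.mul_prod_erase _ _ (Finset.mem_erase.2 ⟨hne, Finset.mem_univ b⟩), ← mul_assoc, mul_comm]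
  congr 1
  · refine Finset.prod_congr rfl fun c hc => ?_
    simp only [Finset.mem_erase] at hc
    simp only [lFactor, if_neg hc.2.1]
  · simp [lFactor, hne, hlt]

theorem rowFactor_right (hab : (b : ℕ) = a + 1) (I : Finset (Fin n)) (lam t : F) (z : Fin n → F)
    (y : F) : rowFactor I b lam t z y =
      commonFactor a b t z y * ((t - z a + y) * (lam + t - z b - (w b I : F) * y)) := by
  have hne : b ≠ a := fun h => by rw [h] at hab; omega
  have hlt : a < b := by rw [Fin.lt_def]; omega
  rw [rowFactor, ← Finset.mul_prod_erase _ _ (Finset.mem_univ a),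
    ← Finset.mul_prod_erase _ _ (Finset.mem_erase.2 ⟨hne, Finset.mem_univ b⟩), ← mul_assoc, mul_comm]
  congr 1
  · refine Finset.prod_congr rfl fun c hc => ?_
    simp only [Finset.mem_erase] at hc
    have hcb : c < b ↔ c < a := by
      have h1 : (c : ℕ) ≠ a := Fin.val_ne_of_ne hc.2.1
      rw [Fin.lt_def, Fin.lt_def]
      omega
    simp only [lFactor, if_neg hc.1, hcb]
  · simp [lFactor, hlt]

/-- The factors of a weight function that involve two of its variables. -/
def pairFactor (t : Fin k → F) (y : F) : F :=
  ∏ a : Fin k, ∏ b ∈ Finset.univ.filter (fun b : Fin k => a < b), (t a - t b + y) / (t a - t b)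

theorem preWeight_eq (I : Finset (Fin n)) (hI : I.card = k) (lam : F) (t : Fin k → F)
    (z : Fin n → F) (y : F) : preWeight I hI lam t z y =
      (∏ r, rowFactor I (I.orderEmbOfFin hI r) lam (t r) z y) * pairFactor t y := rfl

/-- For adjacent `a ∉ I`, `b ∈ I`, the four summands of weight functions that are related by
exchanging `a` and `b` differ in two linear factors only. -/
theorem preWeight_exchange (hab : (b : ℕ) = a + 1) (I : Finset (Fin n)) (hI : I.card = k)
    (ha : a ∉ I) (hb : b ∈ I) (lam y : F) (t : Fin k → F) (z : Fin n → F) :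
    ∃ X τ : F,
      preWeight I hI lam t z y = X * ((τ - z a + y) * (lam - (w b I : F) * y + τ - z b)) ∧
      preWeight I hI lam t (z ∘ Equiv.swap a b) y =
        X * ((τ - z b + y) * (lam - (w b I : F) * y + τ - z a)) ∧
      preWeight (preim (Equiv.swap a b) I) (card_preim _ hI) lam t z y =
        X * ((lam - (w b I : F) * y + y + τ - z a) * (τ - z b)) ∧
      preWeight (preim (Equiv.swap a b) I) (card_preim _ hI) lam t (z ∘ Equiv.swap a b) y =
        X * ((lam - (w b I : F) * y + y + τ - z b) * (τ - z a)) := by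
  have hne : b ≠ a := fun h => by rw [h] at hab; omega
  obtain ⟨r, hr⟩ := exists_orderEmbOfFin_eq hI hb
  have hemb (q : Fin k) (hq : q ∈ Finset.univ.erase r) :
      I.orderEmbOfFin hI q ≠ a ∧ I.orderEmbOfFin hI q ≠ b := by
    refine ⟨fun h => ha (h ▸ I.orderEmbOfFin_mem hI q), fun h => Finset.ne_of_mem_erase hq ?_⟩
    exact (I.orderEmbOfFin hI).injective (h.trans hr.symm)
  have hw : (w a (preim (Equiv.swap a b) I) : F) = (w b I : F) - 1 := by
    rw [w_adjacent hab, w_preim_swap hab hne, if_neg (by simpa [mem_preim] using ha)]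
    push_cast
    ring
  -- Only the row of `b`, which becomes the row of `a` in the swapped subset, changes; all other
  -- rows agree in the four cases.
  have hrest (K : Finset (Fin n)) (z' : Fin n → F) (hK : K = I ∨ K = preim (Equiv.swap a b) I)
      (hz' : z' = z ∨ z' = z ∘ Equiv.swap a b) (hKc : K.card = k) :
      ∏ q ∈ Finset.univ.erase r, rowFactor K (K.orderEmbOfFin hKc q) lam (t q) z' y =
        ∏ q ∈ Finset.univ.erase r, rowFactor I (I.orderEmbOfFin hI q) lam (t q) z y := by
    refine Finset.prod_congr rfl fun q hq => ?_
    obtain ⟨h1, h2⟩ := hemb q hq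
    have h3 : rowFactor K (K.orderEmbOfFin hKc q) lam (t q) z' y =
        rowFactor I (I.orderEmbOfFin hI q) lam (t q) z' y := by
      rcases hK with rfl | rfl
      · rfl
      · rw [orderEmbOfFin_preim_swap hab hI (fun h => ha h.1), Equiv.swap_apply_of_ne_of_ne h1 h2,
          rowFactor_preim_swap hab h1]
    rw [h3]
    rcases hz' with rfl | rfl
    · rfl
    · rw [rowFactor_comp_swap hab h1 h2]
  refine ⟨(∏ q ∈ Finset.univ.erase r, rowFactor I (I.orderEmbOfFin hI q) lam (t q) z y) *
    pairFactor t y * commonFactor a b (t r) z y, t r, ?_, ?_, ?_, ?_⟩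
  all_goals
    rw [preWeight_eq, ← Finset.mul_prod_erase _ _ (Finset.mem_univ r)]
  · rw [hr, rowFactor_right hab]
    ring
  · rw [hrest I _ (.inl rfl) (.inr rfl), hr, rowFactor_right hab, commonFactor_comp_swap]
    simp only [Function.comp_apply, Equiv.swap_apply_left, Equiv.swap_apply_right]
    ring
  · rw [hrest _ _ (.inr rfl) (.inl rfl), orderEmbOfFin_preim_swap hab hI (fun h => ha h.1), hr,
      Equiv.swap_apply_right, rowFactor_left hab, hw]
    ring
  · rw [hrest _ _ (.inr rfl) (.inr rfl), orderEmbOfFin_preim_swap hab hI (fun h => ha h.1), hr,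
      Equiv.swap_apply_right, rowFactor_left hab, hw, commonFactor_comp_swap]
    simp only [Function.comp_apply, Equiv.swap_apply_left, Equiv.swap_apply_right]
    ring

/-- Swapping neighbouring variables permutes the other ordered pairs among themselves; only the pair
(r, q) is reversed. -/
theorem exists_pairFactor_eq {r q : Fin k} (hrq : (q : ℕ) = r + 1) (t : Fin k → F) (y : F) :
    ∃ X : F, pairFactor t y = X * ((t r - t q + y) / (t r - t q)) ∧
      pairFactor (t ∘ Equiv.swap r q) y = X * ((t q - t r + y) / (t q - t r)) := by
  set P : Finset (Fin k × Fin k) := Finset.univ.filter fun x => x.1 < x.2 ∧ x ≠ (r, q) with hP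
  have hsplit (u : Fin k → F) : pairFactor u y =
      (∏ x ∈ P, (u x.1 - u x.2 + y) / (u x.1 - u x.2)) * ((u r - u q + y) / (u r - u q)) := by
    have h1 : pairFactor u y = ∏ x ∈ Finset.univ.filter (fun x : Fin k × Fin k => x.1 < x.2),
        (u x.1 - u x.2 + y) / (u x.1 - u x.2) := by
      rw [Finset.prod_filter, Fintype.prod_prod_type]
      simp only [pairFactor, Finset.prod_filter]
    have h2 : P = (Finset.univ.filter fun x : Fin k × Fin k => x.1 < x.2).erase (r, q) := by
      ext x
      simp [hP, and_comm]
    have h3 : (r, q) ∈ Finset.univ.filter fun x : Fin k × Fin k => x.1 < x.2 := by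
      simp only [Finset.mem_filter, Finset.mem_univ, true_and, Fin.lt_def]
      omega
    rw [h1, h2, Finset.prod_erase_mul _ _ h3]
  refine ⟨_, hsplit t, ?_⟩
  rw [hsplit]
  simp only [Function.comp_apply, Equiv.swap_apply_left, Equiv.swap_apply_right]
  congr 1
  have hmem (x : Fin k × Fin k) (hx : x ∈ P) : (Equiv.swap r q x.1, Equiv.swap r q x.2) ∈ P := by
    simp only [hP, Finset.mem_filter, Finset.mem_univ, true_and, ne_eq, Prod.ext_iff] at hx ⊢
    refine ⟨swap_lt_swap hrq hx.1 hx.2, fun h => ?_⟩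
    rw [Equiv.swap_apply_eq_iff, Equiv.swap_apply_eq_iff, Equiv.swap_apply_left,
      Equiv.swap_apply_right] at h
    have := hx.1
    rw [h.1, h.2, Fin.lt_def] at this
    omega
  exact Finset.prod_nbij' (fun x => (Equiv.swap r q x.1, Equiv.swap r q x.2))
    (fun x => (Equiv.swap r q x.1, Equiv.swap r q x.2)) hmem hmem (fun x _ => by simp)
    (fun x _ => by simp) fun x _ => rfl

/-- This is the two-variable case of the symmetry in u, v of a weight function containing both
adjacent positions. -/
theorem symmetrization_identity (μ u v y p q : F) (hpq : p ≠ q) :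
    (μ - y + p - u) * (p - v) * ((q - u + y) * (μ + q - v)) * ((p - q + y) / (p - q)) +
      (μ - y + q - u) * (q - v) * ((p - u + y) * (μ + p - v)) * ((q - p + y) / (q - p)) =
    (μ - y + p - v) * (p - u) * ((q - v + y) * (μ + q - u)) * ((p - q + y) / (p - q)) +
      (μ - y + q - v) * (q - u) * ((p - v + y) * (μ + p - u)) * ((q - p + y) / (q - p)) := by
  have h1 : p - q ≠ 0 := sub_ne_zero.2 hpq
  have h2 : q - p = -(p - q) := by ring
  rw [h2, div_neg]
  field_simp
  ring

/-- A single summand is not symmetric in `z a`, `z b`; the sum of two summands related by exchanging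
the variables of the rows `a` and `b` is. -/
theorem preWeight_add_preWeight_swap (hab : (b : ℕ) = a + 1) (I : Finset (Fin n)) (hI : I.card = k)
    (lam y : F) (z : Fin n → F) {r q : Fin k} (hr : I.orderEmbOfFin hI r = a)
    (hq : I.orderEmbOfFin hI q = b) (t : Fin k → F) (ht : t r ≠ t q) :
    preWeight I hI lam t z y + preWeight I hI lam (t ∘ Equiv.swap r q) z y =
      preWeight I hI lam t (z ∘ Equiv.swap a b) y +
        preWeight I hI lam (t ∘ Equiv.swap r q) (z ∘ Equiv.swap a b) y := by
  have hb : b ∈ I := hq ▸ I.orderEmbOfFin_mem hI q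
  -- No element of `I` lies strictly between `a` and `b`, so their ranks are consecutive.
  have hrq : (q : ℕ) = r + 1 := by
    have h1 : r < q := (I.orderEmbOfFin hI).lt_iff_lt.1 (by rw [hr, hq, Fin.lt_def]; omega)
    by_contra hne
    have h2 : (r : ℕ) + 1 < k := by omega
    have h3 : r < ⟨r + 1, h2⟩ := by rw [Fin.lt_def]; simp
    have h4 : (⟨r + 1, h2⟩ : Fin k) < q := by rw [Fin.lt_def] at h1 ⊢; simp only; omega
    have h5 := (I.orderEmbOfFin hI).strictMono h3
    have h6 := (I.orderEmbOfFin hI).strictMono h4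
    rw [hr, Fin.lt_def] at h5
    rw [hq, Fin.lt_def] at h6
    omega
  have hrq' : q ≠ r := fun h => by rw [h] at hrq; omega
  obtain ⟨X, hX1, hX2⟩ := exists_pairFactor_eq hrq t y
  have hw : (w a I : F) = (w b I : F) + 1 := by
    rw [w_adjacent hab, if_pos hb]
    push_cast
    rfl
  set R : F := ∏ m ∈ (Finset.univ.erase r).erase q,
    rowFactor I (I.orderEmbOfFin hI m) lam (t m) z y with hR
  have hprod (t' : Fin k → F) (z' : Fin n → F)
      (ht' : ∀ m, m ≠ r → m ≠ q → t' m = t m) (hz' : z' = z ∨ z' = z ∘ Equiv.swap a b) :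
      ∏ m, rowFactor I (I.orderEmbOfFin hI m) lam (t' m) z' y =
        R * (commonFactor a b (t' r) z y * commonFactor a b (t' q) z y) *
          (((lam - (w b I : F) * y) - y + t' r - z' a) * (t' r - z' b) *
            ((t' q - z' a + y) * ((lam - (w b I : F) * y) + t' q - z' b))) := by
    have hc (x : F) : commonFactor a b x z' y = commonFactor a b x z y := by
      rcases hz' with rfl | rfl
      · rfl
      · rw [commonFactor_comp_swap]
    have h1 : ∏ m ∈ (Finset.univ.erase r).erase q,
        rowFactor I (I.orderEmbOfFin hI m) lam (t' m) z' y = R := by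
      refine Finset.prod_congr rfl fun m hm => ?_
      simp only [Finset.mem_erase] at hm
      rw [ht' m hm.2.1 hm.1]
      rcases hz' with rfl | rfl
      · rfl
      · refine rowFactor_comp_swap hab (fun h => hm.2.1 ?_) (fun h => hm.1 ?_) _ _ _ _ _
        · exact (I.orderEmbOfFin hI).injective (h.trans hr.symm)
        · exact (I.orderEmbOfFin hI).injective (h.trans hq.symm)
    rw [← Finset.mul_prod_erase _ _ (Finset.mem_univ r),
      ← Finset.mul_prod_erase _ _ (Finset.mem_erase.2 ⟨hrq', Finset.mem_univ q⟩), h1, hr, hq,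
      rowFactor_left hab, rowFactor_right hab, hc, hc, hw]
    ring
  have hts (m : Fin k) (h1 : m ≠ r) (h2 : m ≠ q) : (t ∘ Equiv.swap r q) m = t m := by
    rw [Function.comp_apply, Equiv.swap_apply_of_ne_of_ne h1 h2]
  have key := symmetrization_identity (lam - (w b I : F) * y) (z a) (z b) y (t r) (t q) ht
  simp only [preWeight_eq]
  rw [hprod t z (fun _ _ _ => rfl) (.inl rfl), hprod t _ (fun _ _ _ => rfl) (.inr rfl),
    hprod _ z hts (.inl rfl), hprod _ _ hts (.inr rfl), hX1, hX2]
  simp only [Function.comp_apply, Equiv.swap_apply_left, Equiv.swap_apply_right]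
  linear_combination (R * (commonFactor a b (t r) z y * commonFactor a b (t q) z y) * X) * key

end WeightFactors

/-! ### Exchange relations for normalized weight functions -/

section Exchange

variable {F : Type*} [Field F] {n k : ℕ} {a b : Fin n}

/-- `∏_{i ∈ I} (λ - (w(i, I) + r) y)`. -/
def shiftProd (r : ℤ) (I : Finset (Fin n)) (lam y : F) : F :=
  ∏ i ∈ I, (lam - ((w i I + r : ℤ) : F) * y)

theorem C_eq_shiftProd (r : ℤ) (σ : Equiv.Perm (Fin n)) (I : Finset (Fin n)) (lam y : F) :
    C r σ I lam y = shiftProd r (preim σ I) lam y :=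
  (Finset.prod_map I σ.symm.toEmbedding
    fun i => lam - ((w i (preim σ I) + r : ℤ) : F) * y).symm

/-- `W_I / (C⁽⁰⁾_I C⁽¹⁾_I)`. -/
def normWeight (I : Finset (Fin n)) (hI : I.card = k) (lam : F) (t : Fin k → F) (z : Fin n → F)
    (y : F) : F :=
  weight I hI lam t z y / (shiftProd 0 I lam y * shiftProd 1 I lam y)

theorem normWeight_congr {I I' : Finset (Fin n)} (h : I = I') (hI : I.card = k) (hI' : I'.card = k)
    (lam : F) (t : Fin k → F) (z : Fin n → F) (y : F) :
    normWeight I hI lam t z y = normWeight I' hI' lam t z y := by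
  subst h
  rfl

theorem weightPlus_eq (σ : Equiv.Perm (Fin n)) (I : Finset (Fin n)) (hI : I.card = k) (lam : F)
    (t : Fin k → F) (z : Fin n → F) (y : F) :
    weightPlus σ I hI lam t z y =
      normWeight (preim σ I) (card_preim σ hI) lam t (z ∘ σ) y / e t y := by
  rw [weightPlus, normWeight, C_eq_shiftProd, C_eq_shiftProd, div_div]
  rfl

/-- Moving `b` to `a` affects only the factor of that element, whose `w` drops by 1 because `b` has
left the subset. -/
theorem exists_shiftProd_eq (hab : (b : ℕ) = a + 1) (I : Finset (Fin n)) (ha : a ∉ I) (hb : b ∈ I)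
    (r : ℤ) (lam y : F) :
    ∃ D : F, shiftProd r I lam y = D * (lam - (w b I : F) * y - r * y) ∧
      shiftProd r (preim (Equiv.swap a b) I) lam y = D * (lam - (w b I : F) * y + y - r * y) := by
  have hne : b ≠ a := fun h => ha (h ▸ hb)
  have hw : w a (preim (Equiv.swap a b) I) = w b I - 1 := by
    rw [w_adjacent hab, w_preim_swap hab hne, if_neg (by simpa [mem_preim] using ha)]
    rfl
  refine ⟨∏ i ∈ I.erase b, (lam - ((w i I + r : ℤ) : F) * y), ?_, ?_⟩
  · rw [shiftProd, ← Finset.prod_erase_mul _ _ hb]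
    push_cast
    ring
  · rw [shiftProd, preim, Finset.prod_map, ← Finset.prod_erase_mul _ _ hb]
    congr 1
    · refine Finset.prod_congr rfl fun i hi => ?_
      have hia : i ≠ a := fun h => ha (h ▸ Finset.mem_of_mem_erase hi)
      have hi' : (Equiv.swap a b).symm.toEmbedding i = i :=
        Equiv.swap_apply_of_ne_of_ne hia (Finset.ne_of_mem_erase hi)
      have := w_preim_swap hab hia I
      rw [preim] at this
      rw [hi', this]
    · have hb' : (Equiv.swap a b).symm.toEmbedding b = a := Equiv.swap_apply_right a b
      rw [preim] at hw
      rw [hb', hw]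
      push_cast
      ring

/-- The four coefficients are the entries of the middle block of R at dynamical parameter `μ` and
spectral parameter `Z`. -/
theorem normWeight_exchange (hab : (b : ℕ) = a + 1) (I : Finset (Fin n)) (hI : I.card = k)
    (ha : a ∉ I) (hb : b ∈ I) (lam y : F) (t : Fin k → F) (z : Fin n → F)
    {μ Z : F} (hμ : μ = lam - (w b I : F) * y) (hZ : Z = z b - z a) (h0 : μ ≠ 0)
    (h1 : μ - y ≠ 0) (h2 : μ + y ≠ 0) (h3 : Z - y ≠ 0) :
    normWeight I hI lam t z y =
        ((μ + y) * Z) / (μ * (Z - y)) * normWeight (preim (Equiv.swap a b) I) (card_preim _ hI)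
          lam t (z ∘ Equiv.swap a b) y +
        -(((μ - Z) * y) / (μ * (Z - y))) * normWeight I hI lam t (z ∘ Equiv.swap a b) y ∧
      normWeight (preim (Equiv.swap a b) I) (card_preim _ hI) lam t z y =
        -(((μ + Z) * y) / (μ * (Z - y))) * normWeight (preim (Equiv.swap a b) I) (card_preim _ hI)
          lam t (z ∘ Equiv.swap a b) y +
        ((μ - y) * Z) / (μ * (Z - y)) * normWeight I hI lam t (z ∘ Equiv.swap a b) y := by
  obtain ⟨D₀, hD₀, hD₀'⟩ := exists_shiftProd_eq hab I ha hb 0 lam y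
  obtain ⟨D₁, hD₁, hD₁'⟩ := exists_shiftProd_eq hab I ha hb 1 lam y
  rw [← hμ, Int.cast_zero, zero_mul, sub_zero] at hD₀ hD₀'
  rw [← hμ, Int.cast_one, one_mul] at hD₁ hD₁'
  rw [add_sub_cancel_right] at hD₁'
  -- Without normalization the diagonal coefficients carry `μ - y` and `μ + y` interchanged. The
  -- normalizations contribute `μ (μ - y)` for `I` and `(μ + y) μ` for its swap, and their ratio
  -- corrects this.
  have hw1 : weight I hI lam t z y =
      (Z * (μ - y)) / (μ * (Z - y)) * weight (preim (Equiv.swap a b) I) (card_preim _ hI)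
          lam t (z ∘ Equiv.swap a b) y +
        -(((μ - Z) * y) / (μ * (Z - y))) * weight I hI lam t (z ∘ Equiv.swap a b) y := by
    simp only [weight]
    rw [mul_left_comm, mul_left_comm (-_), ← mul_add]
    congr 1
    rw [Finset.mul_sum, Finset.mul_sum, ← Finset.sum_add_distrib]
    refine Finset.sum_congr rfl fun s _ => ?_
    obtain ⟨X, τ, e1, e2, e3, e4⟩ := preWeight_exchange hab I hI ha hb lam y (t ∘ s) z
    rw [e1, e2, e4, ← hμ]
    have hzb : z b = z a + Z := by rw [hZ]; ring
    rw [hzb]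
    field_simp
    ring
  have hw2 : weight (preim (Equiv.swap a b) I) (card_preim _ hI) lam t z y =
      -(((μ + Z) * y) / (μ * (Z - y))) * weight (preim (Equiv.swap a b) I) (card_preim _ hI)
          lam t (z ∘ Equiv.swap a b) y +
        (Z * (μ + y)) / (μ * (Z - y)) * weight I hI lam t (z ∘ Equiv.swap a b) y := by
    simp only [weight]
    rw [mul_left_comm, mul_left_comm (_ / _), ← mul_add]
    congr 1
    rw [Finset.mul_sum, Finset.mul_sum, ← Finset.sum_add_distrib]
    refine Finset.sum_congr rfl fun s _ => ?_
    obtain ⟨X, τ, e1, e2, e3, e4⟩ := preWeight_exchange hab I hI ha hb lam y (t ∘ s) z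
    rw [e3, e2, e4, ← hμ]
    have hzb : z b = z a + Z := by rw [hZ]; ring
    rw [hzb]
    field_simp
    ring
  have hdiv (W p q : F) : W / (D₀ * p * (D₁ * q)) = (D₀ * D₁)⁻¹ * (W / (p * q)) := by
    rw [div_eq_mul_inv, div_eq_mul_inv, mul_inv, mul_inv, mul_inv, mul_inv, mul_inv]
    ring
  simp only [normWeight, hD₀, hD₀', hD₁, hD₁', hdiv]
  constructor
  · rw [hw1]
    generalize weight (preim (Equiv.swap a b) I) (card_preim _ hI) lam t (z ∘ Equiv.swap a b) y = W₁
    generalize weight I hI lam t (z ∘ Equiv.swap a b) y = W₂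
    rw [mul_left_comm, mul_left_comm (-_), ← mul_add]
    congr 1
    field_simp
  · rw [hw2]
    generalize weight (preim (Equiv.swap a b) I) (card_preim _ hI) lam t (z ∘ Equiv.swap a b) y = W₁
    generalize weight I hI lam t (z ∘ Equiv.swap a b) y = W₂
    rw [mul_left_comm, mul_left_comm (_ / _), ← mul_add]
    congr 1
    field_simp

theorem preWeight_comp_swap_of_notMem (hab : (b : ℕ) = a + 1) (I : Finset (Fin n)) (hI : I.card = k)
    (ha : a ∉ I) (hb : b ∉ I) (lam y : F) (t : Fin k → F) (z : Fin n → F) :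
    preWeight I hI lam t (z ∘ Equiv.swap a b) y = preWeight I hI lam t z y := by
  rw [preWeight_eq, preWeight_eq]
  congr 1
  exact Finset.prod_congr rfl fun r _ => rowFactor_comp_swap hab
    (fun h => ha (h ▸ I.orderEmbOfFin_mem hI r)) (fun h => hb (h ▸ I.orderEmbOfFin_mem hI r)) ..

/-- If both positions lie in `I`, the permutations are paired by right multiplication with the swap
of the two rows, and the differences cancel in pairs. Otherwise every summand is already symmetric.
Injectivity of `t` keeps the denominators nonzero. -/
theorem weight_comp_swap (hab : (b : ℕ) = a + 1) (I : Finset (Fin n)) (hI : I.card = k)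
    (h : a ∈ I ↔ b ∈ I) (lam y : F) (t : Fin k → F) (ht : Function.Injective t) (z : Fin n → F) :
    weight I hI lam t (z ∘ Equiv.swap a b) y = weight I hI lam t z y := by
  rw [weight, weight]
  congr 1
  by_cases hb : b ∈ I
  · obtain ⟨r, hr⟩ := exists_orderEmbOfFin_eq hI (h.2 hb)
    obtain ⟨q, hq⟩ := exists_orderEmbOfFin_eq hI hb
    have hrq : r ≠ q := fun h' => by
      rw [← h', hr] at hq
      rw [← hq] at hab
      omega
    rw [← sub_eq_zero, ← Finset.sum_sub_distrib]
    refine Finset.sum_involution (fun s _ => s * Equiv.swap r q) (fun s _ => ?_)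
      (fun s _ _ h' => ?_) (fun _ _ => Finset.mem_univ _) (fun s _ => by simp [mul_assoc])
    · have h1 := preWeight_add_preWeight_swap hab I hI lam y z hr hq (t ∘ s)
        (ht.ne (s.injective.ne hrq))
      have h2 : t ∘ ⇑(s * Equiv.swap r q) = (t ∘ s) ∘ Equiv.swap r q := rfl
      rw [h2]
      linear_combination -h1
    · exact hrq (Equiv.swap_eq_one_iff.1 (mul_eq_left.1 h'))
  · exact Finset.sum_congr rfl fun s _ =>
      preWeight_comp_swap_of_notMem hab I hI (fun h' => hb (h.1 h')) hb ..

theorem normWeight_comp_swap (hab : (b : ℕ) = a + 1) (I : Finset (Fin n)) (hI : I.card = k)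
    (h : a ∈ I ↔ b ∈ I) (lam y : F) (t : Fin k → F) (ht : Function.Injective t) (z : Fin n → F) :
    normWeight I hI lam t (z ∘ Equiv.swap a b) y = normWeight I hI lam t z y := by
  rw [normWeight, normWeight, weight_comp_swap hab I hI h lam y t ht]

end Exchange

/-! ### Triangularity -/

section Triangular

variable {F : Type*} [Field F] {n k : ℕ}

/-- If `j r` lies beyond the `r`-th element of `I`, row `r` contains the factor `t r - z (j r)`,
which is zero here. -/
theorem le_of_preWeight_ne_zero {I : Finset (Fin n)} {hI : I.card = k} {lam y : F} {z : Fin n → F}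
    {j : Fin k → Fin n} (h : preWeight I hI lam (z ∘ j) z y ≠ 0) (r : Fin k) :
    j r ≤ I.orderEmbOfFin hI r := by
  by_contra hlt
  rw [not_le] at hlt
  have h0 : lFactor I (I.orderEmbOfFin hI r) (j r) lam ((z ∘ j) r) z y = 0 := by
    rw [lFactor, if_neg hlt.not_gt, if_neg hlt.ne', Function.comp_apply, sub_self]
  rw [preWeight_eq, Finset.prod_eq_zero (Finset.mem_univ r)
    (Finset.prod_eq_zero (Finset.mem_univ (j r)) h0), zero_mul] at h
  exact h rfl

theorem exists_perm_le_of_weight_ne_zero {I : Finset (Fin n)} {hI : I.card = k} {lam y : F}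
    {z : Fin n → F} {j : Fin k → Fin n} (h : weight I hI lam (z ∘ j) z y ≠ 0) :
    ∃ s : Equiv.Perm (Fin k), ∀ r, j (s r) ≤ I.orderEmbOfFin hI r := by
  obtain ⟨s, -, hs⟩ := Finset.exists_ne_zero_of_sum_ne_zero (right_ne_zero_of_mul h)
  exact ⟨s, le_of_preWeight_ne_zero (j := j ∘ s) hs⟩

theorem sum_orderEmbOfFin (I : Finset (Fin n)) (hI : I.card = k) :
    ∑ r, (I.orderEmbOfFin hI r : ℕ) = ∑ i ∈ I, (i : ℕ) := by
  conv_rhs => rw [← I.image_orderEmbOfFin_univ hI]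
  rw [Finset.sum_image fun a _ b _ h => (I.orderEmbOfFin hI).injective h]

theorem sum_comp_eq_sum {j : Fin k → Fin n} (hj : Function.Injective j) {J : Finset (Fin n)}
    (hJ : J.card = k) (hjJ : ∀ r, j r ∈ J) : ∑ r, (j r : ℕ) = ∑ i ∈ J, (i : ℕ) := by
  obtain ⟨s, hs⟩ := exists_perm_orderEmbOfFin hJ hj hjJ
  rw [← sum_orderEmbOfFin J hJ, ← Equiv.sum_comp s fun r => (J.orderEmbOfFin hJ r : ℕ)]
  simp only [hs]

theorem eq_orderEmbOfFin_of_le {I J : Finset (Fin n)} (hI : I.card = k) (hJ : J.card = k)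
    {j : Fin k → Fin n} (hj : Function.Injective j) (hjJ : ∀ r, j r ∈ J)
    (hle : ∀ r, j r ≤ I.orderEmbOfFin hI r) (hsum : ∑ i ∈ I, (i : ℕ) ≤ ∑ i ∈ J, (i : ℕ)) (r : Fin k) :
    j r = I.orderEmbOfFin hI r := by
  have h1 : ∑ r, (j r : ℕ) = ∑ r, (I.orderEmbOfFin hI r : ℕ) := by
    refine le_antisymm (Finset.sum_le_sum fun r _ => hle r) ?_
    rw [sum_orderEmbOfFin, sum_comp_eq_sum hj hJ hjJ]
    exact hsum
  exact Fin.ext ((Finset.sum_eq_sum_iff_of_le (f := fun r => (j r : ℕ))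
    (g := fun r => (I.orderEmbOfFin hI r : ℕ)) fun r _ => hle r).1 h1 r (Finset.mem_univ r))

/-- Termwise domination of enumerations is a partial order; the sum of the elements refines it to a
numerical grading, with equal sums forcing equal sets. -/
theorem sum_le_and_eq_of_weight_ne_zero {I J : Finset (Fin n)} {hI : I.card = k} (hJ : J.card = k)
    {lam y : F} {z : Fin n → F} {j : Fin k → Fin n} (hj : Function.Injective j)
    (hjJ : ∀ r, j r ∈ J) (h : weight I hI lam (z ∘ j) z y ≠ 0) :
    ∑ i ∈ J, (i : ℕ) ≤ ∑ i ∈ I, (i : ℕ) ∧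
      (∑ i ∈ J, (i : ℕ) = ∑ i ∈ I, (i : ℕ) → J = I) := by
  obtain ⟨s, hs⟩ := exists_perm_le_of_weight_ne_zero h
  have hjs : Function.Injective (j ∘ s) := hj.comp s.injective
  have hjsJ (r : Fin k) : (j ∘ s) r ∈ J := hjJ _
  refine ⟨?_, fun heq => ?_⟩
  · rw [← sum_comp_eq_sum hjs hJ hjsJ, ← sum_orderEmbOfFin I hI]
    exact Finset.sum_le_sum fun r _ => hs r
  · have h1 := eq_orderEmbOfFin_of_le hI hJ hjs hjsJ hs heq.ge
    refine (Finset.eq_of_subset_of_card_le (fun i hi => ?_) (by rw [hI, hJ])).symm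
    obtain ⟨r, rfl⟩ := exists_orderEmbOfFin_eq hI hi
    rw [← h1 r]
    exact hjsJ r

/-- At z_I the termwise inequality must be an equality, so exactly one permutation can contribute.
-/
theorem weight_self {I : Finset (Fin n)} (hI : I.card = k) (lam y : F) (z : Fin n → F)
    {j : Fin k → Fin n} (hj : Function.Injective j) (hjI : ∀ r, j r ∈ I) :
    weight I hI lam (z ∘ j) z y = y ^ k * preWeight I hI lam (z ∘ I.orderEmbOfFin hI) z y := by
  obtain ⟨s, hs⟩ := exists_perm_orderEmbOfFin hI hj hjI
  rw [weight, Finset.sum_eq_single s.symm]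
  · congr 2
    ext r
    simp [← hs]
  · intro p _ hp
    by_contra hne
    refine hp (Equiv.ext fun r => hj ?_)
    have h1 := eq_orderEmbOfFin_of_le hI hI (hj.comp p.injective) (fun r => hjI _)
      (le_of_preWeight_ne_zero (j := j ∘ p) hne) le_rfl r
    rw [Function.comp_apply] at h1
    rw [h1, ← hs, Equiv.apply_symm_apply]
  · exact fun h => absurd (Finset.mem_univ _) h

end Triangular

/-! ### Weight functions at fixed points -/

section FixedPoints

variable {n k : ℕ}

/-- The denominators zᵢ - zⱼ - y are permitted for `i = j` too, which inverts `y` as soon as some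
position exists. -/
theorem y_mem_unitsL [NeZero n] : y n ∈ unitsL n := by
  have := z_sub_add_mem_unitsL (0 : Fin n) 0
  rwa [sub_self, zero_add] at this

theorem C_mem_unitsL (r : ℤ) (σ : Equiv.Perm (Fin n)) (I : Finset (Fin n)) :
    C r σ I (lam n) (y n) ∈ unitsL n :=
  prod_mem fun _ _ => lam_sub_mem_unitsL _

theorem e_mem_unitsL (j : Fin k → Fin n) : e (z n ∘ j) (y n) ∈ unitsL n :=
  prod_mem fun _ _ => prod_mem fun _ _ => z_sub_add_mem_unitsL _ _

theorem pairFactor_mem_unitsL {j : Fin k → Fin n} (hj : Function.Injective j) :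
    pairFactor (z n ∘ j) (y n) ∈ unitsL n :=
  prod_mem fun _ _ => prod_mem fun _ hb => div_mem_unitsL (z_sub_add_mem_unitsL _ _)
    (z_sub_mem_unitsL (hj.ne (Finset.mem_filter.1 hb).2.ne))

theorem lFactor_mem_ringL (I : Finset (Fin n)) (i a j : Fin n) (σ : Equiv.Perm (Fin n)) :
    lFactor I i a (lam n) (z n j) (z n ∘ σ) (y n) ∈ ringL n := by
  have hw : ((w i I : ℤ) : RatFun n) * y n ∈ ringL n := mul_mem (intCast_mem _ _) (y_mem n)
  rw [lFactor]
  split_ifs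
  · exact add_mem (sub_mem (z_mem n _) (z_mem n _)) (y_mem n)
  · exact sub_mem (sub_mem (add_mem (lam_mem n) (z_mem n _)) (z_mem n _)) hw
  · exact sub_mem (z_mem n _) (z_mem n _)

theorem weight_mem_ringL (I : Finset (Fin n)) (hI : I.card = k) (σ : Equiv.Perm (Fin n))
    {j : Fin k → Fin n} (hj : Function.Injective j) :
    weight I hI (lam n) (z n ∘ j) (z n ∘ σ) (y n) ∈ ringL n :=
  mul_mem (pow_mem (y_mem n) k) <| sum_mem fun s _ =>
    mul_mem (prod_mem fun _ _ => prod_mem fun _ _ => lFactor_mem_ringL I _ _ _ σ)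
      (pairFactor_mem_unitsL (hj.comp s.injective)).2.1

theorem weightPlusAt_mem (σ : Equiv.Perm (Fin n)) (I : Finset (Fin n)) (hI : I.card = k)
    (J : Finset (Fin n)) (hJ : J.card = k) : weightPlusAt σ I hI J hJ ∈ ringL n := by
  rw [weightPlusAt, weightPlus, div_eq_mul_inv]
  exact mul_mem (weight_mem_ringL _ _ σ (J.orderEmbOfFin hJ).injective)
    (inv_mem_unitsL (mul_mem (mul_mem (C_mem_unitsL _ _ _) (C_mem_unitsL _ _ _))
      (e_mem_unitsL (J.orderEmbOfFin hJ)))).2.1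

theorem orderEmbOfFin_eq_comp (σ : Equiv.Perm (Fin n)) (J : Finset (Fin n)) (hJ : J.card = k) :
    (fun r => z n (J.orderEmbOfFin hJ r)) =
      (z n ∘ σ) ∘ fun r => σ.symm (J.orderEmbOfFin hJ r) := by
  ext r
  simp

theorem symm_orderEmbOfFin_mem (σ : Equiv.Perm (Fin n)) (J : Finset (Fin n)) (hJ : J.card = k)
    (r : Fin k) : σ.symm (J.orderEmbOfFin hJ r) ∈ preim σ J := by
  rw [mem_preim, Equiv.apply_symm_apply]
  exact J.orderEmbOfFin_mem hJ r

theorem weightPlusAt_self_mem_unitsL (σ : Equiv.Perm (Fin n)) (I : Finset (Fin n))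
    (hI : I.card = k) : weightPlusAt σ I hI I hI ∈ unitsL n := by
  rw [weightPlusAt, weightPlus]
  refine div_mem_unitsL ?_ (mul_mem (mul_mem (C_mem_unitsL _ _ _) (C_mem_unitsL _ _ _))
    (e_mem_unitsL (I.orderEmbOfFin hI)))
  rw [weightPerm, orderEmbOfFin_eq_comp σ, weight_self (card_preim σ hI) _ _ _
    (j := fun r => σ.symm (I.orderEmbOfFin hI r)) (σ.symm.injective.comp (I.orderEmbOfFin hI).injective) (symm_orderEmbOfFin_mem σ I hI)]
  refine mul_mem ?_ (mul_mem (prod_mem fun r _ => prod_mem fun a _ => ?_) ?_)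
  · cases k with
    -- For `n = 0` the element `y` need not be a unit, but then only its zeroth power occurs.
    | zero => rw [pow_zero]; exact one_mem _
    | succ k =>
      have : NeZero n := ⟨fun h => by have := card_finset_fin_le I; omega⟩
      exact pow_mem y_mem_unitsL _
  · rw [lFactor]
    split_ifs with h1 h2
    · exact z_sub_add_mem_unitsL _ _
    · rw [h2, Function.comp_apply, add_sub_cancel_right]
      exact lam_sub_mem_unitsL _
    · exact z_sub_mem_unitsL (σ.injective.ne (Ne.symm h2))
  · exact pairFactor_mem_unitsL (j := σ ∘ (preim σ I).orderEmbOfFin (card_preim σ hI))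
      (σ.injective.comp ((preim σ I).orderEmbOfFin _).injective)

theorem sum_preim_le_and_eq_of_weightPlusAt_ne_zero (σ : Equiv.Perm (Fin n)) {I J : Finset (Fin n)}
    (hI : I.card = k) (hJ : J.card = k) (h : weightPlusAt σ I hI J hJ ≠ 0) :
    ∑ i ∈ preim σ J, (i : ℕ) ≤ ∑ i ∈ preim σ I, (i : ℕ) ∧
      (∑ i ∈ preim σ J, (i : ℕ) = ∑ i ∈ preim σ I, (i : ℕ) → J = I) := by
  rw [weightPlusAt, weightPlus, weightPerm, orderEmbOfFin_eq_comp σ] at h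
  obtain ⟨h1, h2⟩ := sum_le_and_eq_of_weight_ne_zero (card_preim σ hJ)
    (σ.symm.injective.comp (J.orderEmbOfFin hJ).injective) (symm_orderEmbOfFin_mem σ J hJ)
    (div_ne_zero_iff.1 h).1
  exact ⟨h1, fun h3 => preim_injective σ (h2 h3)⟩

end FixedPoints

/-! ### Stable classes and stable envelope maps -/

section StableClasses

variable {n : ℕ}

theorem existsUnique_isStableClass (σ : Equiv.Perm (Fin n)) (I : Finset (Fin n)) :
    ∃! κ : HL n I.card, IsStableClass σ I κ := by
  obtain ⟨κ, hκ⟩ := exists_locL_eq I.card fun J =>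
    if hJ : J.card = I.card then ⟨weightPlusAt σ I rfl J hJ, weightPlusAt_mem σ I rfl J hJ⟩ else 0
  have hκ' : IsStableClass σ I κ := fun J hJ => by rw [hκ, dif_pos hJ]
  refine ⟨κ, hκ', fun κ' h => sub_eq_zero.1 ?_⟩
  refine eq_zero_of_forall_locL (card_finset_fin_le I) _ fun J hJ => ?_
  rw [map_sub (locL J hJ), sub_eq_zero]
  exact Subtype.ext ((h J hJ).trans (hκ' J hJ).symm)

theorem isStableClass_stableClass (σ : Equiv.Perm (Fin n)) (I : Finset (Fin n)) :
    IsStableClass σ I (stableClass σ I) :=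
  Classical.epsilon_spec (existsUnique_isStableClass σ I).exists

/-- The restriction of `κ_{σ,I}` to `x_J`, where `J` is an arbitrary subset of `[n]`. -/
def restriction (σ : Equiv.Perm (Fin n)) (J I : Finset (Fin n)) : RatFun n :=
  if h : I.card = J.card then weightPlusAt σ I h J rfl else 0

theorem locL_stableClassX (σ : Equiv.Perm (Fin n)) (I J : Finset (Fin n)) (k : Fin (n + 1))
    (hJ : J.card = k) (hI : I.card = k) :
    (locL J hJ (stableClassX σ I k) : RatFun n) = weightPlusAt σ I hI J hJ := by
  obtain ⟨k, hk⟩ := k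
  obtain rfl : I.card = k := hI
  have h : stableClassX σ I ⟨I.card, hk⟩ = stableClass σ I := Pi.single_eq_same _ _
  rw [h]
  exact isStableClass_stableClass σ I J hJ

theorem locX_stableClassX (σ : Equiv.Perm (Fin n)) (I J : Finset (Fin n)) :
    (locX n (stableClassX σ I) J : RatFun n) = restriction σ J I := by
  rw [locX_apply, restriction]
  split_ifs with h
  · exact locL_stableClassX σ I J ⟨J.card, Nat.lt_succ_of_le (card_finset_fin_le J)⟩ rfl h
  · have h0 : stableClassX σ I ⟨J.card, Nat.lt_succ_of_le (card_finset_fin_le J)⟩ = 0 :=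
      Pi.single_eq_of_ne (fun h' => h (congrArg Fin.val h').symm) _
    rw [h0, map_zero (locL J rfl)]
    rfl

/-- The matrix of restrictions of the stable classes to the fixed points. -/
def restrictionMatrix (σ : Equiv.Perm (Fin n)) : Matrix (Finset (Fin n)) (Finset (Fin n)) (L n) :=
  Matrix.of fun J I => locX n (stableClassX σ I) J

theorem isUnit_det_restrictionMatrix (σ : Equiv.Perm (Fin n)) :
    IsUnit (restrictionMatrix σ).det := by
  have hne {J I : Finset (Fin n)} (h : restrictionMatrix σ J I ≠ 0) :
      ∑ i ∈ preim σ J, (i : ℕ) ≤ ∑ i ∈ preim σ I, (i : ℕ) ∧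
        (∑ i ∈ preim σ J, (i : ℕ) = ∑ i ∈ preim σ I, (i : ℕ) → J = I) := by
    have h1 : restriction σ J I ≠ 0 := fun h0 =>
      h (Subtype.ext ((locX_stableClassX σ I J).trans h0))
    rw [restriction] at h1
    split_ifs at h1 with h2
    · exact sum_preim_le_and_eq_of_weightPlusAt_ne_zero σ h2 rfl h1
    · exact absurd rfl h1
  have hdiag (I : Finset (Fin n)) : IsUnit (restrictionMatrix σ I I) := by
    refine isUnit_of_mem_unitsL ?_
    rw [restrictionMatrix, Matrix.of_apply, locX_stableClassX, restriction, dif_pos rfl]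
    exact weightPlusAt_self_mem_unitsL σ I rfl
  -- Subsets are graded by the sum of the elements of σ⁻¹(I); within one grade only diagonal entries
  -- survive.
  have htri : (restrictionMatrix σ).BlockTriangular fun I => ∑ i ∈ preim σ I, (i : ℕ) :=
    fun J I h => by
      by_contra h0
      exact absurd (hne h0).1 (not_le.2 h)
  rw [htri.det]
  refine IsUnit.prod_iff.2 fun m _ => ?_
  have hblock : (restrictionMatrix σ).toSquareBlock (fun I => ∑ i ∈ preim σ I, (i : ℕ)) m =
      Matrix.diagonal fun I => restrictionMatrix σ I.1 I.1 := by
    ext1 J I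
    rw [Matrix.toSquareBlock_def, Matrix.of_apply, Matrix.diagonal_apply]
    split_ifs with h
    · rw [h]
    · by_contra h0
      exact h (Subtype.ext ((hne h0).2 (J.2.trans I.2.symm)))
  rw [hblock, Matrix.det_diagonal]
  exact IsUnit.prod_univ_iff.2 fun I => hdiag I.1

/-- Elementary tensors `v_I` correspond to subsets `I` of `[n]`. -/
def subsetEquiv (n : ℕ) : (Fin n → Fin 2) ≃ Finset (Fin n) where
  toFun := subsetOf
  invFun I j := if j ∈ I then 0 else 1
  left_inv c := by
    ext j
    rcases Fin.exists_fin_two.1 ⟨c j, rfl⟩ with h | h <;> simp [subsetOf, h]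
  right_inv I := by
    ext j
    simp [subsetOf]

theorem stab_basisV (σ : Equiv.Perm (Fin n)) (c : Fin n → Fin 2) :
    stab σ (basisV n c) = stableClassX σ (subsetOf c) :=
  (basisV n).constr_basis (L n) _ c

/-- In the coordinates given by elementary tensors and fixed points, Stab_σ is multiplication by the
restriction matrix, so its bijectivity reduces to a determinant. -/
theorem locX_stab (σ : Equiv.Perm (Fin n)) :
    locX n ∘ₗ stab σ =
      (restrictionMatrix σ).mulVecLin ∘ₗ
        ((basisV n).reindex (subsetEquiv n)).equivFun.toLinearMap := by
  refine (basisV n).ext fun c => ?_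
  have h1 : ((basisV n).reindex (subsetEquiv n)).equivFun (basisV n c) =
      Pi.single (subsetOf c) 1 := by
    have h2 : basisV n c = (basisV n).reindex (subsetEquiv n) (subsetOf c) := by
      rw [Module.Basis.reindex_apply]
      exact congrArg _ ((subsetEquiv n).symm_apply_apply c).symm
    ext J
    rw [h2, Module.Basis.equivFun_self, Pi.single_apply]
    simp only [eq_comm]
  rw [LinearMap.comp_apply, LinearMap.comp_apply, stab_basisV, LinearEquiv.coe_coe, h1,
    Matrix.mulVecLin_apply, Matrix.mulVec_single_one]
  rfl

theorem stab_bijective (σ : Equiv.Perm (Fin n)) : Function.Bijective (stab σ) := by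
  rw [← Function.Bijective.of_comp_iff' (locX_bijective n), ← LinearMap.coe_comp, locX_stab,
    LinearMap.coe_comp]
  refine Function.Bijective.comp ?_ (LinearEquiv.bijective _)
  have hdet := isUnit_det_restrictionMatrix σ
  refine Function.bijective_iff_has_inverse.2 ⟨(restrictionMatrix σ)⁻¹.mulVecLin, fun v => ?_,
    fun v => ?_⟩
  · simp [Matrix.mulVec_mulVec, Matrix.nonsing_inv_mul _ hdet]
  · simp [Matrix.mulVec_mulVec, Matrix.mul_nonsing_inv _ hdet]

end StableClasses

/-! ### The geometric R-matrices -/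

section RMatrix

variable {n : ℕ} {a b : Fin n}

theorem weightPlusAt_eq {k : ℕ} (σ : Equiv.Perm (Fin n)) (I J : Finset (Fin n)) (hI : I.card = k)
    (hJ : J.card = k) : weightPlusAt σ I hI J hJ =
      normWeight (preim σ I) (card_preim σ hI) (lam n) (z n ∘ J.orderEmbOfFin hJ) (z n ∘ σ) (y n) /
        e (z n ∘ J.orderEmbOfFin hJ) (y n) :=
  weightPlus_eq ..

theorem restriction_mul_swap (hab : (b : ℕ) = a + 1) (σ : Equiv.Perm (Fin n))
    {I : Finset (Fin n)} (h : σ a ∈ I ↔ σ b ∈ I) (J : Finset (Fin n)) :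
    restriction (σ * Equiv.swap a b) J I = restriction σ J I := by
  rw [restriction, restriction]
  split_ifs with hIJ
  · have h1 : preim (σ * Equiv.swap a b) I = preim σ I := by
      rw [preim_mul, preim_swap_eq_self (by rwa [mem_preim, mem_preim])]
    have h2 : z n ∘ ⇑(σ * Equiv.swap a b) = (z n ∘ σ) ∘ Equiv.swap a b := rfl
    rw [weightPlusAt_eq, weightPlusAt_eq, normWeight_congr h1 _ (card_preim σ hIJ), h2,
      normWeight_comp_swap hab (preim σ I) (card_preim σ hIJ) (by rwa [mem_preim, mem_preim]) _ _ _
        ((z_injective n).comp (J.orderEmbOfFin rfl).injective)]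
  · rfl

/-- `I'` is `I` with `σ b` replaced by `σ a`. The factor `e` depends only on the fixed point, so the
exchange relation for `normWeight` passes to restrictions. In the indices of `rEntry` the factor `σ
b` comes first, and 0 marks membership. -/
theorem restriction_exchange (hab : (b : ℕ) = a + 1) (σ : Equiv.Perm (Fin n))
    {I I' : Finset (Fin n)} (ha : σ a ∉ I) (hb : σ b ∈ I)
    (hI' : preim σ I' = preim (Equiv.swap a b) (preim σ I)) {l : ℤ} (hl : l = w b (preim σ I))
    (J : Finset (Fin n)) :
    restriction σ J I =
        rEntry (lam n - (l : RatFun n) * y n) (z n (σ b) - z n (σ a)) (y n) (0, 1) (0, 1) *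
          restriction (σ * Equiv.swap a b) J I +
        rEntry (lam n - (l : RatFun n) * y n) (z n (σ b) - z n (σ a)) (y n) (1, 0) (0, 1) *
          restriction (σ * Equiv.swap a b) J I' ∧
      restriction σ J I' =
        rEntry (lam n - (l : RatFun n) * y n) (z n (σ b) - z n (σ a)) (y n) (0, 1) (1, 0) *
          restriction (σ * Equiv.swap a b) J I +
        rEntry (lam n - (l : RatFun n) * y n) (z n (σ b) - z n (σ a)) (y n) (1, 0) (1, 0) *
          restriction (σ * Equiv.swap a b) J I' := by
  have hcard : I'.card = I.card := by
    have := congrArg Finset.card hI'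
    simpa [preim] using this
  simp only [restriction, hcard]
  split_ifs with hIJ
  · have h1 : preim (σ * Equiv.swap a b) I' = preim σ I := by
      rw [preim_mul, hI', ← preim_mul, Equiv.swap_mul_self]
      ext i
      simp [mem_preim]
    have h2 := preim_mul σ (Equiv.swap a b) I
    have hlam (m : ℤ) : lam n - (l : RatFun n) * y n + (m : RatFun n) * y n ≠ 0 := by
      have := lam_sub_ne_zero n (l - m)
      push_cast at this
      rwa [sub_mul, ← sub_add] at this
    obtain ⟨e1, e2⟩ := normWeight_exchange (k := J.card) hab (preim σ I) (card_preim σ hIJ)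
      (by rwa [mem_preim]) (by rwa [mem_preim]) (lam n) (y n) (z n ∘ J.orderEmbOfFin rfl) (z n ∘ σ)
      (μ := lam n - (l : RatFun n) * y n) (Z := z n (σ b) - z n (σ a)) (by rw [hl]) rfl
      (by simpa using hlam 0) (by simpa [sub_eq_add_neg] using hlam (-1)) (by simpa using hlam 1)
      (z_sub_z_sub_y_ne_zero n _ _)
    simp only [weightPlusAt_eq]
    rw [normWeight_congr hI' _ (card_preim _ (card_preim σ hIJ)),
      normWeight_congr h1 _ (card_preim σ hIJ),
      normWeight_congr h2 _ (card_preim _ (card_preim σ hIJ)), e1, e2]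
    have h3 : z n ∘ ⇑(σ * Equiv.swap a b) = (z n ∘ σ) ∘ Equiv.swap a b := rfl
    simp only [rEntry, h3]
    constructor <;> ring
  · simp

/-- This identifies the dynamical shift of the R-matrix with the shift of `λ` in the weight
functions. -/
theorem sum_hWeight (σ : Equiv.Perm (Fin n)) (c : Fin n → Fin 2) :
    ∑ s ∈ (Finset.univ.filter fun i : Fin n => b < i).map σ.toEmbedding, hWeight (c s) =
      w b (preim σ (subsetOf c)) := by
  rw [w_eq_sum, Finset.sum_map]
  refine Finset.sum_congr rfl fun j _ => ?_
  simp only [mem_preim, subsetOf, Finset.mem_filter, Finset.mem_univ, true_and]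
  rcases Fin.exists_fin_two.1 ⟨c (σ j), rfl⟩ with h | h <;> simp [hWeight, h]

theorem restriction_eq_sum (hab : (b : ℕ) = a + 1) (σ : Equiv.Perm (Fin n)) (c : Fin n → Fin 2)
    (J : Finset (Fin n)) :
    restriction σ J (subsetOf c) =
      ∑ d : Fin 2 × Fin 2,
        rEntry (lam n - ((∑ s ∈ (Finset.univ.filter fun i : Fin n => b < i).map σ.toEmbedding,
            hWeight (c s) : ℤ) : RatFun n) * y n) (z n (σ b) - z n (σ a)) (y n) d
            (c (σ b), c (σ a)) *
          restriction (σ * Equiv.swap a b) J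
            (subsetOf (Function.update (Function.update c (σ b) d.1) (σ a) d.2)) := by
  have hne : σ b ≠ σ a := σ.injective.ne fun h => by rw [h] at hab; omega
  rw [sum_hWeight]
  set l := w b (preim σ (subsetOf c)) with hl
  have hself {p q : Fin 2} (hp : c (σ b) = p) (hq : c (σ a) = q) :
      Function.update (Function.update c (σ b) p) (σ a) q = c := by
    rw [← hp, ← hq, Function.update_eq_self, Function.update_eq_self]
  have hswap {p q : Fin 2} (hp : c (σ b) = p) (hq : c (σ a) = q) :
      preim σ (subsetOf (Function.update (Function.update c (σ b) q) (σ a) p)) =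
        preim (Equiv.swap a b) (preim σ (subsetOf c)) := by
    ext i
    simp only [mem_preim, subsetOf, Finset.mem_filter, Finset.mem_univ, true_and]
    by_cases hia : i = a
    · rw [hia, Equiv.swap_apply_left, Function.update_self, hp]
    by_cases hib : i = b
    · rw [hib, Equiv.swap_apply_right, Function.update_of_ne hne, Function.update_self, hq]
    rw [Equiv.swap_apply_of_ne_of_ne hia hib, Function.update_of_ne (σ.injective.ne hia),
      Function.update_of_ne (σ.injective.ne hib)]
  have hmem (j : Fin n) : j ∈ subsetOf c ↔ c j = 0 := by simp [subsetOf]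
  rw [Fintype.sum_prod_type]
  simp only [Fin.sum_univ_two]
  rcases Fin.exists_fin_two.1 ⟨c (σ b), rfl⟩ with hp | hp <;>
    rcases Fin.exists_fin_two.1 ⟨c (σ a), rfl⟩ with hq | hq <;>
    rw [hp, hq]
  · simp only [rEntry, hself hp hq]
    rw [restriction_mul_swap hab σ (I := subsetOf c) (by rw [hmem, hmem, hp, hq])]
    ring
  · have := (restriction_exchange hab σ (I := subsetOf c) (by rw [hmem, hq]; decide)
      (by rw [hmem, hp]) (hswap hp hq) hl J).1
    rw [this, hself hp hq]
    simp only [rEntry]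
    ring
  -- Here `σ a` is in the subset and `σ b` is not, so the exchange is applied to the swapped tensor
  -- `c'` and its second relation is used; `w b` is the same for both.
  · have hc' := hswap hp hq
    set c' := Function.update (Function.update c (σ b) 0) (σ a) 1 with hcdef
    have hb' : c' (σ b) = 0 := by
      rw [hcdef, Function.update_of_ne hne, Function.update_self]
    have ha' : c' (σ a) = 1 := Function.update_self ..
    have hc : preim σ (subsetOf c) = preim (Equiv.swap a b) (preim σ (subsetOf c')) := by
      rw [hc', ← preim_mul, ← preim_mul, Equiv.swap_mul_self, mul_one]
    have hl' : l = w b (preim σ (subsetOf c')) := by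
      rw [hc', w_preim_swap hab fun h => hne (by rw [h])]
    have := (restriction_exchange hab σ (I := subsetOf c') (I' := subsetOf c)
      (by simp [subsetOf, ha']) (by simp [subsetOf, hb']) hc hl' J).2
    rw [this, hself hp hq]
    simp only [rEntry]
    ring
  · simp only [rEntry, hself hp hq]
    rw [restriction_mul_swap hab σ (I := subsetOf c) (by rw [hmem, hmem, hp, hq])]
    ring

theorem map_sum_smul_eq_sum_mul {R M ι : Type*} [CommRing R] [AddCommGroup M] [Module R M]
    [Fintype ι] (f : M →ₗ[R] R) (r : ι → R) (v : ι → M) :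
    f (∑ i, r i • v i) = ∑ i, r i * f (v i) := by
  simp

/-- Since localization is injective, it suffices to compare restrictions on elementary tensors;
stating it as a composition avoids the inverse of Stab. -/
theorem stab_comp_dynR (hab : (b : ℕ) = a + 1) (σ : Equiv.Perm (Fin n)) :
    stab (σ * Equiv.swap a b) ∘ₗ dynR (σ b) (σ a)
      ((Finset.univ.filter fun i : Fin n => b < i).map σ.toEmbedding) (σ b) (σ a) = stab σ := by
  refine (basisV n).ext fun c => (locX_bijective n).1 (funext fun J => Subtype.ext ?_)
  rw [stab_basisV, locX_stableClassX, restriction_eq_sum hab, LinearMap.comp_apply, dynR,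
    Module.Basis.constr_basis]
  refine (congrArg Subtype.val (map_sum_smul_eq_sum_mul
    (LinearMap.proj J ∘ₗ locX n ∘ₗ stab (σ * Equiv.swap a b)) _ _)).trans ?_
  rw [AddSubmonoidClass.coe_finsetSum]
  refine Finset.sum_congr rfl fun d _ => ?_
  rw [← locX_stableClassX, ← stab_basisV]
  rfl

end RMatrix

end

end DynStab

theorem mainTheorem3 (n : ℕ) :
    (∀ (σ : Equiv.Perm (Fin n)) (I : Finset (Fin n)),
      ∃! κ : DynStab.HL n I.card, DynStab.IsStableClass σ I κ) ∧
    ∃ hStab : ∀ σ : Equiv.Perm (Fin n), Function.Bijective (DynStab.stab σ),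
      ∀ (σ : Equiv.Perm (Fin n)) (a b : Fin n), (b : ℕ) = (a : ℕ) + 1 →
        DynStab.geomR hStab (σ * Equiv.swap a b) σ =
          DynStab.dynR (σ b) (σ a)
            ((Finset.univ.filter fun i : Fin n => b < i).map σ.toEmbedding) (σ b) (σ a) := by
  refine ⟨DynStab.existsUnique_isStableClass, DynStab.stab_bijective, fun σ a b hab => ?_⟩
  refine LinearMap.ext fun v => ?_
  rw [DynStab.geomR, LinearMap.comp_apply, LinearEquiv.coe_coe, LinearEquiv.symm_apply_eq]
  exact (LinearMap.congr_fun (DynStab.stab_comp_dynR hab σ) v).symm
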